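/- **Setting.** Let $\Psi_+$ be the space of Schwartz functions $\varphi:\mathbb R\to\mathbb C$ with support in $[0,\infty)$ and with $\varphi^{(m)}(0)=0$ for all $m\ge 0$, with the Schwartz topology, and let $\Psi_+'$ be its topological dual. A function $h$ on $(0,\infty)$ is regarded as an element of $\Psi_+'$ through $\langle h,\varphi\rangle=\int_0^\infty h\varphi$, provided that these integrals converge and define a continuous functional. On $\Psi_+'$ let $D$ be the weak derivative, $\langle Du,\varphi\rangle=-\langle u,\varphi'\rangle$. For $w\in\mathbb C$ let $K_w(x)=x_+^{w-1}/\Gamma(w)$, understood for $\operatorname{Re}w\le 0$ as a pseudo-function (by analytic continuation in $w$, so that $K_0=\delta$). For $u\in\Psi_+'$ the convolution $u*K_w\in\Psi_+'$ is given by $$\langle u*K_w,\varphi\rangle=\big\langle u(x),\langle K_w(y),\varphi(x+y)\rangle\big\rangle,\qquad \varphi\in\Psi_+ .$$ The inner function $h(x)=\langle K_w(y),\varphi(x+y)\rangle$ is smooth and rapidly decreasing on $[0,\infty)$ but need not vanish at $0$, so the outer pairing is taken as a Hadamard finite part: $\langle u,h\rangle$ is the finite part, as $\varepsilon\downarrow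 0$, of $\langle u,\chi(\cdot/\varepsilon)h\rangle$, where $\chi$ is a smooth cutoff that is $0$ on $(-\infty,r]$ for some $r>0$ and $1$ near $+\infty$. (A function $F$ has finite part $c$ if $F(\varepsilon)=c+b\log\varepsilon+\sum_{p}A_p\,\varepsilon^{p}+o(1)$ as $\varepsilon\downarrow0$, with a finite sum over exponents $p\in\mathbb C\setminus\{0\}$.) The convolution is said to exist if, for every $\varphi\in\Psi_+$, this finite part exists and is the same for all such $\chi$, and the resulting functional of $\varphi$ belongs to $\Psi_+'$. For $\operatorname{Re}z>0$ and $n=\lceil\operatorname{Re}z\rceil$, the fractional derivative of order $z$ is the linear operator $$\mathcal D^z f=(D^nf)*K_{n-z}$$ in $\Psi_+'$, defined for those $f\in\Psi_+'$ for which the convolution exists. For $a\ge 0$ and $\operatorname{Re}z>1$, the complex exponential B-spline $E_z^a:\mathbb R\to\mathbb C$ is the function with Fourier transform $$\int_{\mathbb R}E_z^a(x)e^{-i\omega x}\,dx=\Big(\frac{1-e^{-(a+i\omega)}}{a+i\omega}\Big)^{z}$$ (principal branch; value $1$ where $a+i\omega=0$), and $\binom z\ell=\frac{\Gamma(z+1)}{\Gamma(\ell+1)\Gamma(z-\ell+1)}$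 (equal to $0$ where $z-\ell+1$ is a pole of $\Gamma$). **Proposition.** Let $a\ge 0$ and $z\in\mathbb C$ with $\operatorname{Re}z>1$. The relation $$(\mathcal D+aI)^z\big(e^{-a\,\cdot}f\big)=e^{-a\,\cdot}\,\mathcal D^zf ,\qquad f\in\operatorname{dom}\mathcal D^z,$$ gives a well-defined linear operator $(\mathcal D+aI)^z$ in $\Psi_+'$, with domain $e^{-a\,\cdot}\operatorname{dom}\mathcal D^z$, and: 1. $1\in\Psi_+'$, and $e^{-a\,\cdot}\in\ker(\mathcal D+aI)^z$. 2. $x^{z-1}\in\Psi_+'$, and $x^{z-1}e^{-a\,\cdot}\in\ker(\mathcal D+aI)^z$. 3. $E_z^a\in\Psi_+'$ lies in the domain of $(\mathcal D+aI)^z$, and $$(\mathcal D+aI)^zE_z^a=\sum_{\ell=0}^\infty\binom z\ell(-1)^\ell e^{-\ell a}\,\delta(\cdot-\ell),$$ where the series converges pointwise on $\Psi_+$. In particular $E_z^a$ is an exponential spline of complex order $z$, that is, a solution $F$ of $(\mathcal D+aI)^zF=\sum_{\ell\ge0}c_\ell\,\delta(\cdot-\ell)$ for some bounded sequence $(c_\ell)$.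 -/

import Mathlib

open MeasureTheory Filter Topology Set
open scoped SchwartzMap NNReal ContDiff

noncomputable section

namespace ComplexSpline

/-! ### The Lizorkin space on the half-line and its dual -/

/-- The space of Schwartz functions on the real line that are supported in `[0, ∞)` and all of
whose derivatives vanish at the origin, with the topology of the Schwartz space. -/
def lizorkinPlus : Submodule ℂ 𝓢(ℝ, ℂ) where
  carrier := {φ | (∀ m : ℕ, iteratedDeriv m φ 0 = 0) ∧ tsupport φ ⊆ Ici 0}
  add_mem' := by
    rintro φ ψ ⟨h1, h2⟩ ⟨h3, h4⟩
    refine ⟨fun m => ?_, (tsupport_add (f := φ) (g := ψ)).trans (union_subset h2 h4)⟩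
    have h5 := iteratedDeriv_add (x := (0 : ℝ)) (n := m) (f := φ) (g := ψ)
      ((φ.smooth m).contDiffAt) ((ψ.smooth m).contDiffAt)
    have h6 : ((φ + ψ : 𝓢(ℝ, ℂ)) : ℝ → ℂ) = (φ : ℝ → ℂ) + ψ := rfl
    rw [h6, h5, h1, h3, add_zero]
  zero_mem' := by
    have h6 : ((0 : 𝓢(ℝ, ℂ)) : ℝ → ℂ) = fun _ => 0 := rfl
    refine ⟨fun m => ?_, ?_⟩
    · rw [h6, iteratedDeriv_const]; split_ifs <;> rfl
    · rw [h6]; simp [tsupport]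
  smul_mem' := by
    rintro c φ ⟨h1, h2⟩
    have h6 : ((c • φ : 𝓢(ℝ, ℂ)) : ℝ → ℂ) = c • (φ : ℝ → ℂ) := rfl
    refine ⟨fun m => ?_, ?_⟩
    · rw [h6, iteratedDeriv_const_smul_field, h1, smul_zero]
    · rw [h6]
      exact (closure_mono (Function.support_const_smul_subset c φ)).trans h2

/-- The topological dual of `lizorkinPlus`. -/
abbrev LizorkinDual : Type := lizorkinPlus →L[ℂ] ℂ

theorem lizorkinPlus_eq_zero_of_neg (φ : lizorkinPlus) {x : ℝ} (hx : x < 0) :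
    (φ : 𝓢(ℝ, ℂ)) x = 0 := by
  by_contra h
  exact absurd (φ.2.2 (subset_tsupport _ h)) (not_le.mpr hx)

/-- Differentiation of test functions. -/
def derivTest : lizorkinPlus →L[ℂ] lizorkinPlus :=
  ((SchwartzMap.derivCLM ℂ ℂ).comp lizorkinPlus.subtypeL).codRestrict lizorkinPlus (by
    intro φ
    have h6 : (((SchwartzMap.derivCLM ℂ ℂ).comp lizorkinPlus.subtypeL φ : 𝓢(ℝ, ℂ)) : ℝ → ℂ)
        = deriv ((φ : 𝓢(ℝ, ℂ)) : ℝ → ℂ) := by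
      ext x; exact SchwartzMap.derivCLM_apply ℂ _ x
    refine ⟨fun m => ?_, ?_⟩
    · rw [h6, ← iteratedDeriv_succ']; exact φ.2.1 (m + 1)
    · rw [h6]; exact (closure_minimal support_deriv_subset isClosed_closure).trans φ.2.2)

/-- The weak derivative on the dual, `⟨D u, φ⟩ = - ⟨u, φ'⟩`. -/
def weakDeriv : LizorkinDual →ₗ[ℂ] LizorkinDual where
  toFun u := -(u.comp derivTest)
  map_add' u v := by ext φ; simp; ring
  map_smul' c u := by ext φ; simp

/-- `u` is the functional given by integration against the function `h` on `(0, ∞)`. -/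
def IsRegular (u : LizorkinDual) (h : ℝ → ℂ) : Prop :=
  ∀ φ : lizorkinPlus, IntegrableOn (fun x => h x * (φ : 𝓢(ℝ, ℂ)) x) (Ioi 0) ∧
    u φ = ∫ x in Ioi (0 : ℝ), h x * (φ : 𝓢(ℝ, ℂ)) x

/-- `u` is the functional `∑ ℓ, c ℓ • δ(· - ℓ)`. -/
def IsDeltaSeries (u : LizorkinDual) (c : ℕ → ℂ) : Prop :=
  ∀ φ : lizorkinPlus, HasSum (fun ℓ : ℕ => c ℓ * (φ : 𝓢(ℝ, ℂ)) (ℓ : ℝ)) (u φ)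

/-! ### Multiplication by the exponential -/

/-- A smooth function of temperate growth that equals `exp (-a x)` for `x ≥ 0`; only its values
on `[0, ∞)` matter below. -/
def expCut (a : ℝ≥0) (x : ℝ) : ℝ := Real.smoothTransition (x + 1) * Real.exp (-(a : ℝ) * x)

theorem expCut_of_nonneg (a : ℝ≥0) {x : ℝ} (hx : 0 ≤ x) :
    expCut a x = Real.exp (-(a : ℝ) * x) := by
  rw [expCut, Real.smoothTransition.one_of_one_le (by linarith), one_mul]

theorem expCut_contDiff (a : ℝ≥0) : ContDiff ℝ ∞ (expCut a) := by
  have h1 : ContDiff ℝ ∞ (fun x : ℝ => Real.smoothTransition (x + 1)) :=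
    Real.smoothTransition.contDiff.comp (contDiff_id.add contDiff_const)
  have h2 : ContDiff ℝ ∞ (fun x : ℝ => Real.exp (-(a : ℝ) * x)) := by fun_prop
  exact h1.mul h2

theorem expCut_hasTemperateGrowth (a : ℝ≥0) : (expCut a).HasTemperateGrowth := by
  refine ⟨expCut_contDiff a, fun n => ?_⟩
  have hcont : Continuous (fun x => iteratedFDeriv ℝ n (expCut a) x) :=
    (expCut_contDiff a).continuous_iteratedFDeriv (by exact_mod_cast le_top)
  obtain ⟨C, hC⟩ := (isCompact_Icc (a := (-1 : ℝ)) (b := 1)).exists_bound_of_continuousOn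
    hcont.continuousOn
  refine ⟨0, max C ((a : ℝ) ^ n), fun x => ?_⟩
  rw [pow_zero, mul_one]
  rcases lt_or_ge x (-1) with h | h
  · have h1 : expCut a =ᶠ[𝓝 x] fun _ => 0 := by
      filter_upwards [Iio_mem_nhds h] with y hy
      have hy' : y < -1 := hy
      rw [expCut, Real.smoothTransition.zero_of_nonpos (by linarith), zero_mul]
    have h2 : iteratedFDeriv ℝ n (expCut a) x = 0 := by
      rw [(h1.iteratedFDeriv ℝ n).eq_of_nhds]
      exact congrFun (iteratedFDeriv_fun_zero (𝕜 := ℝ) (E := ℝ) (F := ℝ) (n := n)) x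
    rw [h2, norm_zero]
    exact le_max_of_le_right (by positivity)
  · rcases le_or_gt x 1 with h' | h'
    · exact (hC x ⟨h, h'⟩).trans (le_max_left _ _)
    · have h1 : expCut a =ᶠ[𝓝 x] fun y => Real.exp (-(a : ℝ) * y) := by
        filter_upwards [Ioi_mem_nhds (show (0 : ℝ) < x by linarith)] with y hy
        exact expCut_of_nonneg a (le_of_lt hy)
      refine le_max_of_le_right ?_
      rw [(h1.iteratedFDeriv ℝ n).eq_of_nhds, norm_iteratedFDeriv_eq_norm_iteratedDeriv,
        iteratedDeriv_exp_const_mul, norm_mul, Real.norm_of_nonneg (Real.exp_pos _).le, norm_pow,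
        norm_neg, Real.norm_of_nonneg a.coe_nonneg]
      refine mul_le_of_le_one_right (by positivity) (Real.exp_le_one_iff.mpr ?_)
      have : (0 : ℝ) ≤ a * x := mul_nonneg a.2 (by linarith)
      linarith

theorem expCut_smul_apply (a : ℝ≥0) (φ : lizorkinPlus) (x : ℝ) :
    SchwartzMap.smulLeftCLM ℂ (fun x => (expCut a x : ℂ)) (φ : 𝓢(ℝ, ℂ)) x
      = (Real.exp (-(a : ℝ) * x) : ℂ) * (φ : 𝓢(ℝ, ℂ)) x := by
  have hg : (fun x => (expCut a x : ℂ)).HasTemperateGrowth := by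
    have := expCut_hasTemperateGrowth a
    fun_prop
  rw [SchwartzMap.smulLeftCLM_apply_apply hg, smul_eq_mul]
  rcases lt_or_ge x 0 with h | h
  · rw [lizorkinPlus_eq_zero_of_neg φ h, mul_zero, mul_zero]
  · rw [expCut_of_nonneg a h]

/-- A smooth function vanishing on `(-∞, 0)` is flat at the origin. -/
theorem mem_lizorkinPlus_of_neg (φ : 𝓢(ℝ, ℂ)) (h : ∀ x < 0, φ x = 0) : φ ∈ lizorkinPlus := by
  have hs : tsupport φ ⊆ Ici 0 := by
    refine closure_minimal (fun x hx => ?_) isClosed_Ici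
    by_contra hx'
    exact hx (h x (not_le.mp hx'))
  refine ⟨fun m => ?_, hs⟩
  have hc : Continuous (iteratedDeriv m φ) := (φ.smooth m).continuous_iteratedDeriv m le_rfl
  have h1 : Tendsto (iteratedDeriv m φ) (𝓝[<] 0) (𝓝 (iteratedDeriv m φ 0)) :=
    hc.continuousAt.mono_left nhdsWithin_le_nhds
  have h2 : Tendsto (iteratedDeriv m φ) (𝓝[<] 0) (𝓝 0) := by
    refine tendsto_const_nhds.congr' ?_
    filter_upwards [self_mem_nhdsWithin] with x hx
    have h3 : (φ : ℝ → ℂ) =ᶠ[𝓝 x] fun _ => 0 := by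
      filter_upwards [Iio_mem_nhds hx] with y hy using h y hy
    rw [(h3.iteratedDeriv_eq m), iteratedDeriv_const]
    split_ifs <;> rfl
  exact tendsto_nhds_unique h1 h2

/-- The map `φ ↦ exp (-a ·) φ` on test functions. -/
def expMulTest (a : ℝ≥0) : lizorkinPlus →L[ℂ] lizorkinPlus :=
  ((SchwartzMap.smulLeftCLM ℂ (fun x => (expCut a x : ℂ))).comp lizorkinPlus.subtypeL).codRestrict
    lizorkinPlus (fun φ => mem_lizorkinPlus_of_neg _ fun x hx => by
      have := expCut_smul_apply a φ x
      rw [lizorkinPlus_eq_zero_of_neg φ hx, mul_zero] at this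
      exact this)

theorem expMulTest_apply (a : ℝ≥0) (φ : lizorkinPlus) (x : ℝ) :
    (expMulTest a φ : 𝓢(ℝ, ℂ)) x = (Real.exp (-(a : ℝ) * x) : ℂ) * (φ : 𝓢(ℝ, ℂ)) x :=
  expCut_smul_apply a φ x

/-- The product `exp (-a ·) u` of a functional with the exponential. -/
def expMul (a : ℝ≥0) : LizorkinDual →ₗ[ℂ] LizorkinDual where
  toFun u := u.comp (expMulTest a)
  map_add' u v := by ext φ; simp
  map_smul' c u := by ext φ; simp

/-! ### Hadamard finite part -/

/-- `c` is the finite part of `F ε` as `ε ↓ 0`: after subtracting finitely many terms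
`A ε ^ p` with `p ≠ 0` and a term `b log ε`, the function `F` tends to `c`. -/
def HasFinitePart (F : ℝ → ℂ) (c : ℂ) : Prop :=
  ∃ (P : Finset ℂ) (A : ℂ → ℂ) (b : ℂ), (0 : ℂ) ∉ P ∧
    Tendsto (fun ε : ℝ => F ε - ∑ p ∈ P, A p * (ε : ℂ) ^ p - b * (Real.log ε : ℂ))
      (𝓝[>] 0) (𝓝 c)

theorem HasFinitePart.congr {F G : ℝ → ℂ} {c : ℂ} (h : HasFinitePart F c)
    (hFG : ∀ ε, 0 < ε → F ε = G ε) : HasFinitePart G c := by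
  obtain ⟨P, A, b, h0, hT⟩ := h
  refine ⟨P, A, b, h0, hT.congr' ?_⟩
  filter_upwards [self_mem_nhdsWithin] with ε hε
  rw [hFG ε hε]

theorem HasFinitePart.zero : HasFinitePart (fun _ => 0) 0 :=
  ⟨∅, 0, 0, by simp, by simp⟩

theorem HasFinitePart.smul {F : ℝ → ℂ} {c : ℂ} (k : ℂ) (h : HasFinitePart F c) :
    HasFinitePart (fun ε => k * F ε) (k * c) := by
  obtain ⟨P, A, b, h0, hT⟩ := h
  refine ⟨P, fun p => k * A p, k * b, h0, (hT.const_mul k).congr fun ε => ?_⟩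
  simp only [mul_assoc, ← Finset.mul_sum]
  ring

theorem HasFinitePart.add {F G : ℝ → ℂ} {c d : ℂ} (h : HasFinitePart F c)
    (h' : HasFinitePart G d) : HasFinitePart (fun ε => F ε + G ε) (c + d) := by
  classical
  obtain ⟨P, A, b, h0, hT⟩ := h
  obtain ⟨P', A', b', h0', hT'⟩ := h'
  refine ⟨P ∪ P', fun p => (if p ∈ P then A p else 0) + (if p ∈ P' then A' p else 0), b + b',
    by simp [h0, h0'], (hT.add hT').congr fun ε => ?_⟩
  have e1 : ∑ p ∈ P ∪ P', (if p ∈ P then A p else 0) * (ε : ℂ) ^ p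
      = ∑ p ∈ P, A p * (ε : ℂ) ^ p := by
    simp only [ite_mul, zero_mul]
    rw [← Finset.sum_filter]
    congr 1
    ext p; simp +contextual
  have e2 : ∑ p ∈ P ∪ P', (if p ∈ P' then A' p else 0) * (ε : ℂ) ^ p
      = ∑ p ∈ P', A' p * (ε : ℂ) ^ p := by
    simp only [ite_mul, zero_mul]
    rw [← Finset.sum_filter]
    congr 1
    ext p; simp +contextual
  simp only [add_mul, Finset.sum_add_distrib, e1, e2]
  ring

/-- Uniqueness of the finite part. -/
theorem finitePart_unique_aux (P : Finset ℂ) : ∀ (A : ℂ → ℂ) (b c : ℂ), (0 : ℂ) ∉ P →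
    Tendsto (fun ε : ℝ => c + b * (Real.log ε : ℂ) + ∑ p ∈ P, A p * (ε : ℂ) ^ p)
      (𝓝[>] 0) (𝓝 0) → b = 0 ∧ c = 0 := by
  classical
  induction P using Finset.induction_on with
  | empty =>
    intro A b c _ h
    simp only [Finset.sum_empty, add_zero] at h
    have hb : b = 0 := by
      by_contra hb
      have h1 : Tendsto (fun ε : ℝ => ((c + b * (Real.log ε : ℂ)) - c) / b) (𝓝[>] 0)
          (𝓝 ((0 - c) / b)) := (h.sub_const c).div_const b
      have h2 : Tendsto (fun ε : ℝ => (Real.log ε : ℂ)) (𝓝[>] 0) (𝓝 ((0 - c) / b)) := by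
        refine h1.congr fun ε => ?_
        field_simp
        ring
      have h3 : Tendsto (fun ε : ℝ => Real.log ε) (𝓝[>] 0) (𝓝 ((0 - c) / b).re) :=
        (Complex.continuous_re.tendsto _).comp h2
      exact not_tendsto_nhds_of_tendsto_atBot Real.tendsto_log_nhdsGT_zero _ h3
    refine ⟨hb, ?_⟩
    simp only [hb, zero_mul, add_zero] at h
    exact tendsto_nhds_unique tendsto_const_nhds h
  | insert q P hq ih =>
    intro A b c h0 h
    have hq0 : q ≠ 0 := fun e => h0 (e ▸ Finset.mem_insert_self q P)
    have hP0 : (0 : ℂ) ∉ P := fun e => h0 (Finset.mem_insert_of_mem e)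
    have hqn : 0 < ‖q‖ := norm_pos_iff.mpr hq0
    set t : ℝ := 1 / ‖q‖ with ht
    have htpos : 0 < t := by positivity
    set s : ℝ := Real.exp t with hs
    have hspos : 0 < s := Real.exp_pos t
    have hlogs : Real.log s = t := Real.log_exp t
    have hsne : (s : ℂ) ≠ 0 := by exact_mod_cast hspos.ne'
    have hsq : (s : ℂ) ^ q ≠ 1 := by
      rw [Complex.cpow_def_of_ne_zero hsne, ← Complex.ofReal_log hspos.le, hlogs]
      intro h1
      obtain ⟨k, hk⟩ := Complex.exp_eq_one_iff.mp h1
      have h2 : ‖(t : ℂ) * q‖ = 1 := by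
        rw [norm_mul, Complex.norm_of_nonneg htpos.le, ht]
        field_simp
      rw [hk] at h2
      simp only [norm_mul, Complex.norm_intCast, Complex.norm_ofNat, Complex.norm_real,
        Real.norm_of_nonneg Real.pi_pos.le, Complex.norm_I, mul_one] at h2
      rcases eq_or_ne k 0 with rfl | hk0
      · simp at h2
      · have h3 : (1 : ℝ) ≤ |(k : ℝ)| := by exact_mod_cast Int.one_le_abs hk0
        nlinarith [Real.pi_gt_three]
    have hscale : Tendsto (fun ε : ℝ => s * ε) (𝓝[>] 0) (𝓝[>] 0) := by
      refine tendsto_nhdsWithin_iff.mpr ⟨?_, ?_⟩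
      · have : Tendsto (fun ε : ℝ => s * ε) (𝓝 0) (𝓝 (s * 0)) :=
          (continuous_const.mul continuous_id).tendsto 0
        rw [mul_zero] at this
        exact this.mono_left nhdsWithin_le_nhds
      · filter_upwards [self_mem_nhdsWithin] with ε hε
        exact mul_pos hspos hε
    have h1 := (h.comp hscale).sub (h.const_mul ((s : ℂ) ^ q))
    rw [mul_zero, sub_zero] at h1
    have h2 := ih (fun p => A p * ((s : ℂ) ^ p - (s : ℂ) ^ q)) (b * (1 - (s : ℂ) ^ q))
      (c * (1 - (s : ℂ) ^ q) + b * t) hP0 (h1.congr' (by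
        filter_upwards [self_mem_nhdsWithin] with ε hε
        have hε' : 0 < ε := hε
        have e1 : ∀ p : ℂ, ((s * ε : ℝ) : ℂ) ^ p = (s : ℂ) ^ p * (ε : ℂ) ^ p := fun p => by
          push_cast
          exact Complex.mul_cpow_ofReal_nonneg hspos.le hε'.le p
        have e2 : Real.log (s * ε) = t + Real.log ε := by
          rw [Real.log_mul hspos.ne' hε'.ne', hlogs]
        have e3 : ∑ p ∈ P, A p * ((s : ℂ) ^ p - (s : ℂ) ^ q) * (ε : ℂ) ^ p
            = ∑ p ∈ P, A p * ((s : ℂ) ^ p * (ε : ℂ) ^ p)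
              - (s : ℂ) ^ q * ∑ p ∈ P, A p * (ε : ℂ) ^ p := by
          rw [Finset.mul_sum, ← Finset.sum_sub_distrib]
          exact Finset.sum_congr rfl fun p _ => by ring
        simp only [Function.comp, e1, e2, e3, Finset.sum_insert hq]
        push_cast
        ring))
    have hb : b = 0 := by
      rcases mul_eq_zero.mp h2.1 with h3 | h3
      · exact h3
      · exact absurd (sub_eq_zero.mp h3).symm hsq
    refine ⟨hb, ?_⟩
    have h4 := h2.2
    rw [hb, zero_mul, add_zero] at h4
    rcases mul_eq_zero.mp h4 with h3 | h3
    · exact h3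
    · exact absurd (sub_eq_zero.mp h3).symm hsq

theorem HasFinitePart.eq_zero {c : ℂ} (h : HasFinitePart (fun _ => 0) c) : c = 0 := by
  obtain ⟨P, A, b, h0, hT⟩ := h
  have h1 := hT.sub_const c
  rw [sub_self] at h1
  have h2 := finitePart_unique_aux P (fun p => -A p) (-b) (-c) h0 (h1.congr fun ε => by
    simp only [neg_mul, Finset.sum_neg_distrib]
    ring)
  exact neg_eq_zero.mp h2.2

/-- A smooth cutoff that vanishes for `x` near `0` (and for `x < 0`) and equals one for large
`x`. -/
structure IsCutoff (χ : ℝ → ℝ) : Prop where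
  smooth : ContDiff ℝ ∞ χ
  zero_near : ∃ r > 0, ∀ x ≤ r, χ x = 0
  one_far : ∃ R, ∀ x ≥ R, χ x = 1

theorem exists_isCutoff : ∃ χ : ℝ → ℝ, IsCutoff χ :=
  ⟨fun x => Real.smoothTransition (x - 1),
    Real.smoothTransition.contDiff.comp (contDiff_id.sub contDiff_const),
    ⟨1, one_pos, fun x hx => Real.smoothTransition.zero_of_nonpos (by linarith)⟩,
    ⟨2, fun x hx => Real.smoothTransition.one_of_one_le (by linarith)⟩⟩

open Classical in
/-- The function `h` as an element of the test space, where `h` belongs to it (`0` otherwise). -/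
def asTest (h : ℝ → ℂ) : lizorkinPlus :=
  if H : ∃ θ : lizorkinPlus, ((θ : 𝓢(ℝ, ℂ)) : ℝ → ℂ) = h then H.choose else 0

/-- The pairing of `u` with a function `h` which is smooth and rapidly decreasing on `[0, ∞)`, but
need not be flat at the origin, exists as a Hadamard finite part and equals `c`: the number `c` is
the finite part, as `ε ↓ 0`, of the pairing of `u` with the test function `χ(·/ε) h`, whichever
cutoff `χ` is used. -/
def HasFinitePartPairing (u : LizorkinDual) (h : ℝ → ℂ) (c : ℂ) : Prop :=
  ∀ χ : ℝ → ℝ, IsCutoff χ →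
    HasFinitePart (fun ε => u (asTest fun x => (χ (x / ε) : ℂ) * h x)) c

/-! ### The kernels, convolution with them, and the fractional derivative -/

/-- The truncated power kernel `x ↦ x₊ ^ (w - 1) / Γ(w)`. -/
def K (w : ℂ) (x : ℝ) : ℂ := if 0 < x then (x : ℂ) ^ (w - 1) / Complex.Gamma w else 0

/-- The pairing of the kernel `K w`, as a distribution on the real line, with a function `ψ` which
is smooth and rapidly decreasing on `[0, ∞)`. If `Re w > 0`, this is `∫ K w · ψ`. If `Re w ≤ 0`,
where `K w` is not locally integrable, it is the finite part of that integral, that is, its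
analytic continuation in `w`, written as `(-1) ^ m ∫ K (w + m) · ψ⁽ᵐ⁾` with the least natural
number `m` for which `Re (w + m) > 0`; in particular, `K 0` is the Dirac distribution. -/
def kernelPairing (w : ℂ) (ψ : ℝ → ℂ) : ℂ :=
  (-1) ^ (⌊-w.re⌋ + 1).toNat * ∫ y in Ioi (0 : ℝ),
    K (w + ((⌊-w.re⌋ + 1).toNat : ℂ)) y * iteratedDeriv (⌊-w.re⌋ + 1).toNat ψ y

/-- `v` is the convolution `u * K w`, that is, `⟨v, φ⟩ = ⟨u(x), ⟨K w (y), φ(x + y)⟩⟩` for all test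
functions `φ`. The inner function of `x` is in general not flat at the origin, so the outer
pairing is a finite part. -/
def IsConvKernel (u : LizorkinDual) (w : ℂ) (v : LizorkinDual) : Prop :=
  ∀ φ : lizorkinPlus,
    HasFinitePartPairing u (fun x => kernelPairing w fun y => (φ : 𝓢(ℝ, ℂ)) (x + y)) (v φ)

/-- The graph of the fractional derivative of order `z`: all pairs `(f, (D ^ n f) * K (n - z))`
with `n = ⌈Re z⌉`, where `f` is such that the convolution exists. -/
def fracDerivGraph (z : ℂ) : Submodule ℂ (LizorkinDual × LizorkinDual) where
  carrier := {p | IsConvKernel ((weakDeriv ^ ⌈z.re⌉₊) p.1) ((⌈z.re⌉₊ : ℂ) - z) p.2}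
  add_mem' := by
    intro p q hp hq φ χ hχ
    refine ((hp φ χ hχ).add (hq φ χ hχ)).congr fun ε _ => ?_
    simp
  zero_mem' := by
    intro φ χ hχ
    refine HasFinitePart.zero.congr fun ε _ => ?_
    simp
  smul_mem' := by
    intro c p hp φ χ hχ
    refine ((hp φ χ hχ).smul c).congr fun ε _ => ?_
    simp

/-- The fractional derivative `f ↦ (D ^ n f) * K (n - z)`, `n = ⌈Re z⌉`, of complex order `z`, as a
linear operator in the dual of the test space, defined wherever the convolution exists. -/
def fracDeriv (z : ℂ) : LizorkinDual →ₗ.[ℂ] LizorkinDual := (fracDerivGraph z).toLinearPMap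

theorem mem_fracDeriv_graph_iff (z : ℂ) (f g : LizorkinDual) :
    (f, g) ∈ (fracDeriv z).graph ↔
      IsConvKernel ((weakDeriv ^ ⌈z.re⌉₊) f) ((⌈z.re⌉₊ : ℂ) - z) g := by
  rw [fracDeriv, Submodule.toLinearPMap_graph_eq]
  · exact Iff.rfl
  · rintro ⟨f, g⟩ h hf
    obtain ⟨χ, hχ⟩ := exists_isCutoff
    ext φ
    have hf' : f = 0 := hf
    subst hf'
    exact HasFinitePart.eq_zero ((h φ χ hχ).congr fun ε _ => by simp)

/-- The operator `(𝒟 + aI) ^ z` in the dual of the test space, whose graph consists of the pairs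
`(exp (-a ·) f, exp (-a ·) 𝒟 ^ z f)` with `f` in the domain of `𝒟 ^ z`. -/
def expFracDeriv (a : ℝ≥0) (z : ℂ) : LizorkinDual →ₗ.[ℂ] LizorkinDual :=
  ((fracDeriv z).graph.map ((expMul a).prodMap (expMul a))).toLinearPMap

/-- The kernel of `(𝒟 + aI) ^ z`. -/
def expFracKer (a : ℝ≥0) (z : ℂ) : Set LizorkinDual := {F | (F, 0) ∈ (expFracDeriv a z).graph}

/-- `F` is an exponential spline of complex order `z` for the parameter `a`: a solution of
`(𝒟 + aI) ^ z F = ∑ ℓ, c ℓ • δ(· - ℓ)` for some bounded sequence `c`. -/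
def IsExponentialSpline (a : ℝ≥0) (z : ℂ) (F : LizorkinDual) : Prop :=
  ∃ c : ℕ → ℂ, (∃ C : ℝ, ∀ ℓ, ‖c ℓ‖ ≤ C) ∧
    ∃ G : LizorkinDual, IsDeltaSeries G c ∧ (F, G) ∈ (expFracDeriv a z).graph

/-! ### Complex exponential B-splines -/

/-- `Ω(ξ, a) = (1 - exp (-(a + iξ))) / (a + iξ)`, with its limit `1` at `a + iξ = 0`. -/
def Ω (a : ℝ≥0) (ξ : ℝ) : ℂ :=
  if ((a : ℝ) : ℂ) + Complex.I * ξ = 0 then 1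
  else (1 - Complex.exp (-(((a : ℝ) : ℂ) + Complex.I * ξ))) / (((a : ℝ) : ℂ) + Complex.I * ξ)

/-- The complex exponential B-spline `E_z^a`, that is, the function with Fourier transform
`∫ E(x) exp (-iξx) dx = Ω(ξ, a) ^ z` (principal branch), given by Fourier inversion. -/
def expBSpline (a : ℝ≥0) (z : ℂ) (x : ℝ) : ℂ :=
  (1 / (2 * Real.pi) : ℂ) * ∫ ξ : ℝ, Ω a ξ ^ z * Complex.exp (Complex.I * ξ * x)

/-- The binomial coefficient `Γ(z + 1) / (Γ(ℓ + 1) Γ(z - ℓ + 1))`. It is `0` where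
`z - ℓ + 1` is a pole of `Γ`, as `Complex.Gamma` is `0` there. -/
def cbinom (z : ℂ) (ℓ : ℕ) : ℂ :=
  Complex.Gamma (z + 1) / (Complex.Gamma (ℓ + 1) * Complex.Gamma (z - ℓ + 1))

end ComplexSpline

end

/-!
The operator `(𝒟 + aI) ^ z` is well defined because multiplication by `exp (-a ·)` is injective on
the dual (`expMul_injective`): its image on test functions contains every compactly supported test
function, and these are dense.

For the other claims, let `n = ⌈Re z⌉` and `w = n - z`, so that `0 ≤ Re w < 1`. Everything is
expressed through the Weyl integrals `weyl v ψ x = ∫ K v (y) ψ (x + y) dy`, which satisfy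
`weyl (v + 1) ψ' = -weyl v ψ`, `weyl 1 ψ' = -ψ` and `weyl a ∘ weyl b = weyl (a + b)`. The inner
function of the convolution with `K w` is `h = -weyl (w + 1) φ'`, for `Re w = 0` as well as for
`Re w > 0`, and so `weyl (1 - w) h' = -weyl 2 φ'' = -φ` (`weyl_deriv_neg_weyl`).

Let `u = ∑ ℓ, c ℓ K_z(· - ℓ)` with bounded coefficients. Integration by parts gives
`⟨D ^ n u, θ⟩ = -∑ ℓ, c ℓ weyl (1 - w) θ' ℓ`. For `θ = χ(·/ε) h` with `ε` small, the cutoff is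
invisible in the terms with `ℓ ≥ 1`, which are therefore equal to `c ℓ φ(ℓ)`. In the term with
`ℓ = 0` it contributes a multiple of `ε ^ (-w)` and a null function, so this term has the finite
part `c 0 φ(0) = 0` (`hasFinitePart_weyl_deriv_cutoff_mul`); if `w = 0` the term vanishes
identically. Hence `𝒟 ^ z u = ∑ ℓ, c ℓ δ(· - ℓ)` (`mem_fracDeriv_graph_of_hasSum`). The
function `x ^ (z - 1)` is the case of a single term at `ℓ = 0`, where `δ` is zero on test functions.
The constant `1` has `D 1 = 0`.

Finally `E_z^a = exp (-a ·) ∑ ℓ, (-1) ^ ℓ (z choose ℓ) K_z(· - ℓ)` (`expBSpline_eq`). For `a > 0`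
the right-hand side is continuous and integrable, and with `s = a + iξ` its Fourier transform is
`(∑ ℓ, (-1) ^ ℓ (z choose ℓ) exp (-ℓ s)) s ^ (-z) = (1 - exp (-s)) ^ z s ^ (-z) = Ω(ξ, a) ^ z` by
Euler's integral and the binomial series, so that Fourier inversion applies. The case `a = 0`
follows by dominated convergence as `a ↓ 0`.
-/

namespace ComplexSpline

/-! ### The truncated power kernel -/

theorem norm_K {v : ℂ} {y : ℝ} (hy : 0 < y) :
    ‖K v y‖ = y ^ (v.re - 1) / ‖Complex.Gamma v‖ := by
  rw [K, if_pos hy, norm_div, Complex.norm_cpow_eq_rpow_re_of_pos hy]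
  simp

theorem K_of_nonpos {v : ℂ} {y : ℝ} (hy : y ≤ 0) : K v y = 0 := if_neg (not_lt.mpr hy)

theorem measurable_K (v : ℂ) : Measurable (K v) := by
  unfold K
  refine Measurable.ite measurableSet_Ioi ?_ measurable_const
  exact (Complex.measurable_ofReal.pow_const _).div_const _

theorem support_K_subset (v : ℂ) : Function.support (K v) ⊆ Ioi 0 := fun y hy => by
  by_contra h
  exact hy (K_of_nonpos (not_lt.mp h))

/-- An exponent `N` for which `K v y / (1 + y) ^ N` is integrable on `(0, ∞)` if `Re v > 0`. -/
noncomputable def decayExp (v : ℂ) : ℕ := ⌈v.re⌉₊ + 1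

theorem integrableOn_norm_K_mul {v : ℂ} (hv : 0 < v.re) :
    IntegrableOn (fun y => ‖K v y‖ * ((1 + y) ^ decayExp v)⁻¹) (Ioi 0) := by
  have hN : v.re + 1 ≤ (decayExp v : ℝ) := by
    have := Nat.le_ceil v.re
    simp only [decayExp]; push_cast; linarith
  have hm : Measurable (fun y => ‖K v y‖ * ((1 + y) ^ decayExp v)⁻¹) := by
    have := measurable_K v
    fun_prop
  rw [← Ioc_union_Ioi_eq_Ioi zero_le_one]
  refine IntegrableOn.union ?_ ?_
  · have h1 : IntegrableOn (fun y : ℝ => y ^ (v.re - 1) / ‖Complex.Gamma v‖) (Ioc 0 1) := by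
      have h2 := (intervalIntegral.intervalIntegrable_rpow' (a := 0) (b := 1)
        (r := v.re - 1) (by linarith)).1
      exact h2.div_const _
    refine h1.mono' hm.aestronglyMeasurable ?_
    filter_upwards [ae_restrict_mem measurableSet_Ioc] with y hy
    rw [norm_mul, norm_norm, norm_K hy.1, norm_inv, norm_pow,
      Real.norm_of_nonneg (by linarith [hy.1])]
    refine mul_le_of_le_one_right (div_nonneg (Real.rpow_nonneg hy.1.le _) (norm_nonneg _)) ?_
    exact inv_le_one_of_one_le₀ (one_le_pow₀ (by linarith [hy.1]))
  · have h1 : IntegrableOn (fun y : ℝ => y ^ (-2 : ℝ) / ‖Complex.Gamma v‖) (Ioi 1) :=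
      (integrableOn_Ioi_rpow_of_lt (by norm_num) one_pos).div_const _
    refine h1.mono' hm.aestronglyMeasurable ?_
    filter_upwards [ae_restrict_mem measurableSet_Ioi] with y hy
    have hy1 : 1 < y := hy
    have hy0 : 0 < y := by linarith
    rw [norm_mul, norm_norm, norm_K hy0, norm_inv, norm_pow, Real.norm_of_nonneg (by linarith),
      div_mul_eq_mul_div]
    gcongr
    have h3 : ((1 + y) ^ decayExp v)⁻¹ ≤ y ^ (-(decayExp v : ℝ)) := by
      rw [Real.rpow_neg hy0.le, Real.rpow_natCast]
      gcongr
      linarith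
    calc y ^ (v.re - 1) * ((1 + y) ^ decayExp v)⁻¹
        ≤ y ^ (v.re - 1) * y ^ (-(decayExp v : ℝ)) := by gcongr
      _ = y ^ (v.re - 1 + -(decayExp v : ℝ)) := (Real.rpow_add hy0 _ _).symm
      _ ≤ y ^ (-2 : ℝ) := Real.rpow_le_rpow_of_exponent_le hy1.le (by linarith)

/-! ### Weyl fractional integrals of Schwartz functions -/

/-- The Weyl fractional integral of order `v`, that is, the pairing of the kernel `K v` with the
translates of a function. -/
noncomputable def weyl (v : ℂ) (ψ : ℝ → ℂ) (x : ℝ) : ℂ := ∫ y in Ioi (0 : ℝ), K v y * ψ (x + y)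

/-- The derivative of a Schwartz function, as a Schwartz function. -/
noncomputable abbrev schwartzDeriv : 𝓢(ℝ, ℂ) →L[ℂ] 𝓢(ℝ, ℂ) := SchwartzMap.derivCLM ℂ ℂ

theorem coe_schwartzDeriv (ψ : 𝓢(ℝ, ℂ)) : (schwartzDeriv ψ : ℝ → ℂ) = deriv ψ := by
  ext x; exact SchwartzMap.derivCLM_apply ℂ _ x

theorem hasDerivAt_schwartz (ψ : 𝓢(ℝ, ℂ)) (x : ℝ) : HasDerivAt ψ (schwartzDeriv ψ x) x := by
  rw [coe_schwartzDeriv]; exact (ψ.differentiableAt).hasDerivAt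

theorem schwartz_decay (ψ : 𝓢(ℝ, ℂ)) (N : ℕ) :
    ∃ C : ℝ, 0 ≤ C ∧ ∀ x : ℝ, ‖ψ x‖ ≤ C * ((1 + |x|) ^ N)⁻¹ := by
  refine ⟨2 ^ N * (Finset.Iic (N, 0)).sup (fun m => SchwartzMap.seminorm ℂ m.1 m.2) ψ,
    by positivity, fun x => ?_⟩
  have h := SchwartzMap.one_add_le_sup_seminorm_apply (𝕜 := ℂ) (m := (N, 0)) (k := N) (n := 0)
    le_rfl le_rfl ψ x
  rw [norm_iteratedFDeriv_zero, Real.norm_eq_abs] at h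
  rw [← div_eq_mul_inv, le_div_iff₀ (by positivity), mul_comm]
  exact h

theorem inv_one_add_abs_add_pow_le (x : ℝ) {y : ℝ} (hy : 0 ≤ y) (N : ℕ) :
    ((1 + |x + y|) ^ N)⁻¹ ≤ (1 + |x|) ^ N * ((1 + y) ^ N)⁻¹ := by
  rw [inv_le_iff_one_le_mul₀ (by positivity), mul_comm ((1 + |x|) ^ N), mul_assoc, ← mul_pow,
    ← div_eq_inv_mul, le_div_iff₀ (by positivity), one_mul]
  gcongr
  have h1 : y ≤ |x| + |x + y| := by
    rcases abs_cases x with h | h <;> rcases abs_cases (x + y) with h' | h' <;> linarith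
  nlinarith [mul_nonneg (abs_nonneg x) (abs_nonneg (x + y))]

theorem inv_one_add_abs_add_pow_le_of_nonneg {x y : ℝ} (hx : 0 ≤ x) (hy : 0 ≤ y) (k N : ℕ) :
    ((1 + |x + y|) ^ (k + N))⁻¹ ≤ ((1 + x) ^ k)⁻¹ * ((1 + y) ^ N)⁻¹ := by
  rw [← mul_inv, abs_of_nonneg (add_nonneg hx hy), pow_add]
  gcongr <;> linarith

theorem integrableOn_K_mul {v : ℂ} (hv : 0 < v.re) {g : ℝ → ℂ} (hg : Measurable g) {C : ℝ}
    (hC : ∀ y > 0, ‖g y‖ ≤ C * ((1 + y) ^ decayExp v)⁻¹) :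
    IntegrableOn (fun y => K v y * g y) (Ioi 0) := by
  refine ((integrableOn_norm_K_mul hv).const_mul C).mono'
    ((measurable_K v).mul hg).aestronglyMeasurable ?_
  filter_upwards [ae_restrict_mem measurableSet_Ioi] with y hy
  rw [norm_mul]
  calc ‖K v y‖ * ‖g y‖ ≤ ‖K v y‖ * (C * ((1 + y) ^ decayExp v)⁻¹) := by gcongr; exact hC y hy
    _ = _ := by ring

theorem integrableOn_weyl {v : ℂ} (hv : 0 < v.re) (ψ : 𝓢(ℝ, ℂ)) (x : ℝ) :
    IntegrableOn (fun y => K v y * ψ (x + y)) (Ioi 0) := by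
  obtain ⟨C, hC0, hC⟩ := schwartz_decay ψ (decayExp v)
  refine integrableOn_K_mul hv (C := C * (1 + |x|) ^ decayExp v)
    (ψ.continuous.measurable.comp (measurable_const_add x)) fun y hy => (hC _).trans ?_
  rw [mul_assoc]
  gcongr
  exact inv_one_add_abs_add_pow_le x (le_of_lt hy) _

theorem hasDerivAt_weyl {v : ℂ} (hv : 0 < v.re) (ψ : 𝓢(ℝ, ℂ)) (x : ℝ) :
    HasDerivAt (weyl v ψ) (weyl v (schwartzDeriv ψ) x) x := by
  obtain ⟨C, hC0, hC⟩ := schwartz_decay (schwartzDeriv ψ) (decayExp v)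
  have hmeas : ∀ (θ : 𝓢(ℝ, ℂ)) (x : ℝ),
      AEStronglyMeasurable (fun y => K v y * θ (x + y)) (volume.restrict (Ioi 0)) := fun θ x =>
    ((measurable_K v).mul (θ.continuous.measurable.comp
      (measurable_const_add x))).aestronglyMeasurable
  refine (hasDerivAt_integral_of_dominated_loc_of_deriv_le (Metric.ball_mem_nhds x one_pos)
    (Eventually.of_forall fun t => hmeas ψ t) (integrableOn_weyl hv ψ x)
    (hF'_meas := hmeas (schwartzDeriv ψ) x)
    (F' := fun t y => K v y * schwartzDeriv ψ (t + y))
    (bound := fun y => C * (2 + |x|) ^ decayExp v * (‖K v y‖ * ((1 + y) ^ decayExp v)⁻¹))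
    (h_bound := ?_) (bound_integrable := (integrableOn_norm_K_mul hv).const_mul _)
    (h_diff := ?_)).2
  · filter_upwards [ae_restrict_mem measurableSet_Ioi] with y hy t ht
    have hy' : 0 < y := hy
    have h1 : |t| ≤ 1 + |x| := by
      rw [Metric.mem_ball, Real.dist_eq] at ht
      have := abs_sub_abs_le_abs_sub t x
      linarith
    rw [norm_mul]
    calc ‖K v y‖ * ‖schwartzDeriv ψ (t + y)‖
        ≤ ‖K v y‖ * (C * ((1 + |t|) ^ decayExp v * ((1 + y) ^ decayExp v)⁻¹)) := by
          gcongr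
          refine (hC _).trans ?_
          gcongr
          exact inv_one_add_abs_add_pow_le t hy'.le _
      _ ≤ ‖K v y‖ * (C * ((2 + |x|) ^ decayExp v * ((1 + y) ^ decayExp v)⁻¹)) := by
          gcongr ‖K v y‖ * (C * (?_ ^ _ * _))
          linarith
      _ = _ := by ring
  · refine Eventually.of_forall fun y t _ => ?_
    exact ((hasDerivAt_schwartz ψ (t + y)).comp_add_const t y).const_mul _

theorem iteratedDeriv_weyl {v : ℂ} (hv : 0 < v.re) (m : ℕ) (ψ : 𝓢(ℝ, ℂ)) :
    iteratedDeriv m (weyl v ψ) = weyl v (schwartzDeriv^[m] ψ) := by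
  induction m generalizing ψ with
  | zero => simp
  | succ m ih =>
    have : deriv (weyl v ψ) = weyl v (schwartzDeriv ψ) :=
      funext fun x => (hasDerivAt_weyl hv ψ x).deriv
    rw [iteratedDeriv_succ', this, ih, Function.iterate_succ_apply]

theorem contDiff_weyl {v : ℂ} (hv : 0 < v.re) (ψ : 𝓢(ℝ, ℂ)) : ContDiff ℝ ∞ (weyl v ψ) := by
  refine contDiff_of_differentiable_iteratedDeriv fun m _ => ?_
  rw [iteratedDeriv_weyl hv]
  exact fun x => (hasDerivAt_weyl hv _ x).differentiableAt

/-- Rapid decrease of the integrand of a Weyl integral, in absolute value. -/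
theorem weyl_norm_decay {v : ℂ} (hv : 0 < v.re) (ψ : 𝓢(ℝ, ℂ)) (k : ℕ) :
    ∃ C : ℝ, 0 ≤ C ∧ ∀ x : ℝ, 0 ≤ x →
      ∫ y in Ioi (0 : ℝ), ‖K v y * ψ (x + y)‖ ≤ C * ((1 + x) ^ k)⁻¹ := by
  obtain ⟨C, hC0, hC⟩ := schwartz_decay ψ (k + decayExp v)
  have hnn : 0 ≤ ∫ y in Ioi (0 : ℝ), ‖K v y‖ * ((1 + y) ^ decayExp v)⁻¹ :=
    setIntegral_nonneg measurableSet_Ioi fun y hy => by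
      have : (0 : ℝ) < y := hy
      positivity
  refine ⟨C * ∫ y in Ioi (0 : ℝ), ‖K v y‖ * ((1 + y) ^ decayExp v)⁻¹, by positivity,
    fun x hx => ?_⟩
  rw [mul_right_comm, ← integral_const_mul]
  refine setIntegral_mono_on (integrableOn_weyl hv ψ x).norm
    ((integrableOn_norm_K_mul hv).const_mul _) measurableSet_Ioi fun y hy => ?_
  have hy' : 0 < y := hy
  rw [norm_mul]
  calc ‖K v y‖ * ‖ψ (x + y)‖
      ≤ ‖K v y‖ * (C * (((1 + x) ^ k)⁻¹ * ((1 + y) ^ decayExp v)⁻¹)) := by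
        gcongr
        refine (hC _).trans ?_
        gcongr
        exact inv_one_add_abs_add_pow_le_of_nonneg hx hy'.le _ _
    _ = _ := by ring

theorem weyl_decay {v : ℂ} (hv : 0 < v.re) (ψ : 𝓢(ℝ, ℂ)) (k : ℕ) :
    ∃ C : ℝ, 0 ≤ C ∧ ∀ x : ℝ, 0 ≤ x → ‖weyl v ψ x‖ ≤ C * ((1 + x) ^ k)⁻¹ := by
  obtain ⟨C, hC0, hC⟩ := weyl_norm_decay hv ψ k
  exact ⟨C, hC0, fun x hx => (norm_integral_le_integral_norm _).trans (hC x hx)⟩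

theorem hasDerivAt_K_add_one {v : ℂ} (hv : v ≠ 0) {y : ℝ} (hy : 0 < y) :
    HasDerivAt (K (v + 1)) (K v y) y := by
  have h1 : HasDerivAt (fun y : ℝ => (y : ℂ) ^ v / Complex.Gamma (v + 1))
      (v * (y : ℂ) ^ (v - 1) / Complex.Gamma (v + 1)) y :=
    (hasDerivAt_ofReal_cpow_const hy.ne' hv).div_const _
  have h2 : v * (y : ℂ) ^ (v - 1) / Complex.Gamma (v + 1) = K v y := by
    rw [K, if_pos hy, Complex.Gamma_add_one v hv, mul_div_mul_left _ _ hv]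
  rw [h2] at h1
  refine h1.congr_of_eventuallyEq ?_
  filter_upwards [Ioi_mem_nhds hy] with t ht
  have ht' : 0 < t := ht
  rw [K, if_pos ht', add_sub_cancel_right]

theorem schwartz_tendsto_K_mul (v : ℂ) (ψ : 𝓢(ℝ, ℂ)) (x : ℝ) :
    Tendsto (fun y => K v y * ψ (x + y)) atTop (𝓝 0) := by
  obtain ⟨C, hC0, hC⟩ := schwartz_decay ψ (decayExp v)
  have hN : v.re + 1 ≤ (decayExp v : ℝ) := by
    have := Nat.le_ceil v.re
    simp only [decayExp]; push_cast; linarith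
  have h0 : Tendsto (fun y : ℝ => C * (1 + |x|) ^ decayExp v / ‖Complex.Gamma v‖ * y ^ (-2 : ℝ))
      atTop (𝓝 0) := by
    simpa using (tendsto_rpow_neg_atTop (y := 2) two_pos).const_mul
      (C * (1 + |x|) ^ decayExp v / ‖Complex.Gamma v‖)
  refine squeeze_zero_norm' ?_ h0
  filter_upwards [Ioi_mem_atTop 1] with y hy
  have hy1 : 1 < y := hy
  have hy0 : 0 < y := by linarith
  have h3 : ((1 + y) ^ decayExp v)⁻¹ ≤ y ^ (-(decayExp v : ℝ)) := by
    rw [Real.rpow_neg hy0.le, Real.rpow_natCast]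
    gcongr
    linarith
  rw [norm_mul, norm_K hy0]
  calc y ^ (v.re - 1) / ‖Complex.Gamma v‖ * ‖ψ (x + y)‖
      ≤ y ^ (v.re - 1) / ‖Complex.Gamma v‖ *
        (C * ((1 + |x|) ^ decayExp v * y ^ (-(decayExp v : ℝ)))) := by
        gcongr
        refine (hC _).trans ?_
        gcongr
        exact (inv_one_add_abs_add_pow_le x hy0.le _).trans (by gcongr)
    _ = C * (1 + |x|) ^ decayExp v / ‖Complex.Gamma v‖ *
        (y ^ (v.re - 1) * y ^ (-(decayExp v : ℝ))) := by ring
    _ ≤ _ := by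
        rw [← Real.rpow_add hy0]
        gcongr
        · exact hy1.le
        · linarith

/-- Integration by parts for Weyl integrals. -/
theorem weyl_add_one_deriv {v : ℂ} (hv : 0 < v.re) (ψ : 𝓢(ℝ, ℂ)) (x : ℝ) :
    weyl (v + 1) (schwartzDeriv ψ) x = -weyl v ψ x := by
  have hv0 : v ≠ 0 := fun h => by simp [h] at hv
  have hv1 : 0 < (v + 1).re := by simp; linarith
  have h := integral_Ioi_mul_deriv_eq_deriv_mul (a := 0) (a' := 0) (b' := 0)
    (u := K (v + 1)) (u' := K v) (v := fun y => ψ (x + y))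
    (v' := fun y => schwartzDeriv ψ (x + y))
    (fun y hy => hasDerivAt_K_add_one hv0 hy)
    (fun y _ => (hasDerivAt_schwartz ψ (x + y)).comp_const_add x y)
    (integrableOn_weyl hv1 _ x) (integrableOn_weyl hv ψ x) ?_ (schwartz_tendsto_K_mul _ _ _)
  · simpa [weyl] using h
  · have h1 : Tendsto (fun y : ℝ => (y : ℂ) ^ v / Complex.Gamma (v + 1) * ψ (x + y)) (𝓝[>] 0)
        (𝓝 (((0 : ℝ) : ℂ) ^ v / Complex.Gamma (v + 1) * ψ (x + 0))) := by
      refine Tendsto.mono_left ?_ nhdsWithin_le_nhds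
      refine ((Complex.continuousAt_ofReal_cpow_const 0 v (Or.inl hv)).div_const _).mul ?_
      exact (ψ.continuous.comp (continuous_const_add x)).continuousAt
    rw [Complex.ofReal_zero, Complex.zero_cpow hv0, zero_div, zero_mul] at h1
    refine h1.congr' ?_
    filter_upwards [self_mem_nhdsWithin] with y hy
    have : (0 : ℝ) < y := hy
    simp [K, this]

theorem weyl_one_deriv (ψ : 𝓢(ℝ, ℂ)) (x : ℝ) : weyl 1 (schwartzDeriv ψ) x = -ψ x := by
  have hi := integrableOn_weyl (v := 1) (by simp) (schwartzDeriv ψ) x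
  have hK : EqOn (fun y => K 1 y * schwartzDeriv ψ (x + y)) (fun y => schwartzDeriv ψ (x + y))
      (Ioi 0) := fun y hy => by
    have : (0 : ℝ) < y := hy
    simp [K, this]
  have ht : Tendsto (fun y => ψ (x + y)) atTop (𝓝 0) := by
    refine (schwartz_tendsto_K_mul 1 ψ x).congr' ?_
    filter_upwards [Ioi_mem_atTop 0] with y hy
    have : (0 : ℝ) < y := hy
    simp [K, this]
  rw [weyl, setIntegral_congr_fun measurableSet_Ioi hK,
    integral_Ioi_of_hasDerivAt_of_tendsto' (f := fun y => ψ (x + y)) (m := 0)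
      (fun y _ => (hasDerivAt_schwartz ψ (x + y)).comp_const_add x y)
      (hi.congr_fun hK measurableSet_Ioi) ht]
  simp

/-- `weyl` as an integral over the whole line. -/
theorem weyl_eq_integral (v : ℂ) (ψ : ℝ → ℂ) (x : ℝ) : weyl v ψ x = ∫ y, K v y * ψ (x + y) := by
  refine setIntegral_eq_integral_of_forall_compl_eq_zero fun y hy => ?_
  rw [K_of_nonpos (not_lt.mp hy), zero_mul]

/-- The kernels form a convolution semigroup, by Euler's beta integral. -/
theorem integral_K_mul_K {a b : ℂ} (ha : 0 < a.re) (hb : 0 < b.re) (u : ℝ) :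
    ∫ s, K a s * K b (u - s) = K (a + b) u := by
  rcases le_or_gt u 0 with hu | hu
  · rw [K_of_nonpos hu]
    refine integral_eq_zero_of_ae (Eventually.of_forall fun s => ?_)
    rcases le_or_gt s 0 with hs | hs
    · simp [K_of_nonpos hs]
    · simp [K_of_nonpos (show u - s ≤ 0 by linarith)]
  · have h1 : ∫ s, K a s * K b (u - s) = ∫ s in Ioo 0 u, K a s * K b (u - s) := by
      symm
      refine setIntegral_eq_integral_of_forall_compl_eq_zero fun s hs => ?_
      rcases le_or_gt s 0 with hs0 | hs0
      · rw [K_of_nonpos hs0, zero_mul]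
      · rw [K_of_nonpos (show u - s ≤ 0 by by_contra h; exact hs ⟨hs0, by linarith⟩), mul_zero]
    have h2 : ∫ s in Ioo 0 u, K a s * K b (u - s)
        = ∫ s in Ioo 0 u, (Complex.Gamma a)⁻¹ * (Complex.Gamma b)⁻¹ *
          ((s : ℂ) ^ (a - 1) * ((u : ℂ) - s) ^ (b - 1)) := by
      refine setIntegral_congr_fun measurableSet_Ioo fun s hs => ?_
      simp only [K, if_pos hs.1, if_pos (sub_pos.mpr hs.2), Complex.ofReal_sub]
      ring
    rw [h1, h2, integral_const_mul, ← integral_Ioc_eq_integral_Ioo,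
      ← intervalIntegral.integral_of_le hu.le, Complex.betaIntegral_scaled a b hu, K, if_pos hu]
    have hab := Complex.Gamma_mul_Gamma_eq_betaIntegral ha hb
    have ga := Complex.Gamma_ne_zero_of_re_pos ha
    have gb := Complex.Gamma_ne_zero_of_re_pos hb
    have gab := Complex.Gamma_ne_zero_of_re_pos (show 0 < (a + b).re by simp; linarith)
    field_simp
    rw [mul_assoc, mul_comm (Complex.betaIntegral a b), ← hab, mul_comm]

/-- The semigroup property of Weyl integrals. -/
theorem weyl_weyl {a b : ℂ} (ha : 0 < a.re) (hb : 0 < b.re) (ψ : 𝓢(ℝ, ℂ)) (x : ℝ) :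
    weyl a (weyl b ψ) x = weyl (a + b) ψ x := by
  obtain ⟨C, hC0, hC⟩ := schwartz_decay ψ (decayExp a + decayExp b)
  have hC' : ∀ s t : ℝ, 0 < s → 0 < t → ‖ψ (x + (s + t))‖ ≤
      C * (1 + |x|) ^ (decayExp a + decayExp b) *
        (((1 + s) ^ decayExp a)⁻¹ * ((1 + t) ^ decayExp b)⁻¹) := fun s t hs ht => by
    refine (hC _).trans ?_
    rw [mul_assoc]
    gcongr
    refine (inv_one_add_abs_add_pow_le x (by positivity) _).trans ?_
    gcongr
    have := inv_one_add_abs_add_pow_le_of_nonneg hs.le ht.le (decayExp a) (decayExp b)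
    rwa [abs_of_pos (by positivity)] at this
  have hprod : Integrable (fun p : ℝ × ℝ => K a p.1 * K b p.2 * ψ (x + (p.1 + p.2)))
      (volume.prod volume) := by
    have hga : Integrable (fun y => ‖K a y‖ * ((1 + y) ^ decayExp a)⁻¹) :=
      (integrableOn_iff_integrable_of_support_subset fun y hy =>
        support_K_subset a fun h => hy (by simp [h])).mp (integrableOn_norm_K_mul ha)
    have hgb : Integrable (fun y => ‖K b y‖ * ((1 + y) ^ decayExp b)⁻¹) :=
      (integrableOn_iff_integrable_of_support_subset fun y hy =>
        support_K_subset b fun h => hy (by simp [h])).mp (integrableOn_norm_K_mul hb)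
    refine ((hga.mul_prod hgb).const_mul (C * (1 + |x|) ^ (decayExp a + decayExp b))).mono' ?_ ?_
    · have h1 := measurable_K a
      have h2 := measurable_K b
      have h3 := ψ.continuous.measurable
      exact Measurable.aestronglyMeasurable (by fun_prop)
    · refine Eventually.of_forall fun p => ?_
      rcases le_or_gt p.1 0 with h1 | h1
      · simp [K_of_nonpos h1]
      rcases le_or_gt p.2 0 with h2 | h2
      · simp [K_of_nonpos h2]
      rw [norm_mul, norm_mul]
      calc ‖K a p.1‖ * ‖K b p.2‖ * ‖ψ (x + (p.1 + p.2))‖ ≤ ‖K a p.1‖ * ‖K b p.2‖ *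
            (C * (1 + |x|) ^ (decayExp a + decayExp b) *
            (((1 + p.1) ^ decayExp a)⁻¹ * ((1 + p.2) ^ decayExp b)⁻¹)) := by
            gcongr; exact hC' _ _ h1 h2
        _ = _ := by ring
  -- the shear `(s, t) ↦ (s, s + t)` preserves the measure
  have hshear : Integrable (fun p : ℝ × ℝ => K a p.1 * K b (p.2 - p.1) * ψ (x + p.2))
      (volume.prod volume) := by
    have h := (measurePreserving_prod_sub (volume : Measure ℝ) (volume : Measure ℝ)
      ).integrable_comp_of_integrable hprod
    refine h.congr (Eventually.of_forall fun p => ?_)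
    simp [Function.comp]
  calc weyl a (weyl b ψ) x = ∫ s, K a s * ∫ t, K b t * ψ (x + s + t) := by
        simp only [weyl_eq_integral]
    _ = ∫ s, ∫ u, K a s * K b (u - s) * ψ (x + u) := by
        congr 1; ext s
        rw [← integral_const_mul, ← integral_sub_right_eq_self _ s]
        congr 1; ext u
        rw [show x + s + (u - s) = x + u by ring]; ring
    _ = ∫ u, ∫ s, K a s * K b (u - s) * ψ (x + u) := integral_integral_swap hshear
    _ = weyl (a + b) ψ x := by
        rw [weyl_eq_integral]
        congr 1; ext u
        rw [integral_mul_const, integral_K_mul_K ha hb]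

/-! ### Cutoffs and finite parts -/

theorem HasFinitePart.congr_eventually {F G : ℝ → ℂ} {c : ℂ} (h : HasFinitePart F c)
    (hFG : F =ᶠ[𝓝[>] 0] G) : HasFinitePart G c := by
  obtain ⟨P, A, b, h0, hT⟩ := h
  refine ⟨P, A, b, h0, hT.congr' ?_⟩
  filter_upwards [hFG] with ε hε
  rw [hε]

theorem HasFinitePart.const (c : ℂ) : HasFinitePart (fun _ => c) c :=
  ⟨∅, 0, 0, by simp, by simp⟩

/-- A smooth function which, together with all its derivatives, is rapidly decreasing on
`[0, ∞)`. -/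
structure IsRapid (h : ℝ → ℂ) : Prop where
  smooth : ContDiff ℝ ∞ h
  decay : ∀ m k : ℕ, ∃ C : ℝ, ∀ x : ℝ, 0 ≤ x → ‖iteratedDeriv m h x‖ ≤ C * ((1 + x) ^ k)⁻¹

theorem isRapid_weyl {v : ℂ} (hv : 0 < v.re) (ψ : 𝓢(ℝ, ℂ)) : IsRapid (weyl v ψ) where
  smooth := contDiff_weyl hv ψ
  decay m k := by
    obtain ⟨C, -, hC⟩ := weyl_decay hv (schwartzDeriv^[m] ψ) k
    exact ⟨C, fun x hx => by rw [iteratedDeriv_weyl hv]; exact hC x hx⟩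

theorem IsRapid.neg {h : ℝ → ℂ} (hh : IsRapid h) : IsRapid (fun x => -h x) where
  smooth := hh.smooth.neg
  decay m k := by
    obtain ⟨C, hC⟩ := hh.decay m k
    refine ⟨C, fun x hx => ?_⟩
    rw [iteratedDeriv_fun_neg, norm_neg]
    exact hC x hx

theorem IsCutoff.bounded {χ : ℝ → ℝ} (hχ : IsCutoff χ) : ∃ M : ℝ, ∀ x, |χ x| ≤ M := by
  obtain ⟨r, hr, h0⟩ := hχ.zero_near
  obtain ⟨R, h1⟩ := hχ.one_far
  obtain ⟨C, hC⟩ := (isCompact_Icc (a := r) (b := R)).exists_bound_of_continuousOn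
    hχ.smooth.continuous.continuousOn
  refine ⟨max C 1, fun x => ?_⟩
  rcases le_or_gt x r with hx | hx
  · simp [h0 x hx]
  · rcases le_or_gt R x with hx' | hx'
    · simp [h1 x hx']
    · exact (hC x ⟨hx.le, hx'.le⟩).trans (le_max_left _ _)

theorem IsCutoff.hasCompactSupport_deriv {χ : ℝ → ℝ} (hχ : IsCutoff χ) :
    HasCompactSupport (deriv χ) := by
  obtain ⟨r, hr, h0⟩ := hχ.zero_near
  obtain ⟨R, h1⟩ := hχ.one_far
  refine HasCompactSupport.intro (isCompact_Icc (a := r) (b := R)) fun x hx => ?_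
  rcases lt_or_ge x r with hx1 | hx1
  · have : χ =ᶠ[𝓝 x] fun _ => 0 := by
      filter_upwards [Iio_mem_nhds hx1] with y hy using h0 y (le_of_lt hy)
    rw [this.deriv_eq, deriv_const]
  · have hx2 : R < x := by by_contra h; exact hx ⟨hx1, not_lt.mp h⟩
    have : χ =ᶠ[𝓝 x] fun _ => 1 := by
      filter_upwards [Ioi_mem_nhds hx2] with y hy using h1 y (le_of_lt hy)
    rw [this.deriv_eq, deriv_const]

/-- Cutting off a rapidly decreasing function near the origin yields a test function. -/
theorem exists_cutoff_mul {χ : ℝ → ℝ} (hχ : IsCutoff χ) {h : ℝ → ℂ} (hh : IsRapid h) {ε : ℝ}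
    (hε : 0 < ε) :
    ∃ θ : lizorkinPlus, ((θ : 𝓢(ℝ, ℂ)) : ℝ → ℂ) = fun x => (χ (x / ε) : ℂ) * h x := by
  obtain ⟨r, hr, h0⟩ := hχ.zero_near
  obtain ⟨R, h1⟩ := hχ.one_far
  set f : ℝ → ℂ := fun x => (χ (x / ε) : ℂ) * h x with hf
  have hzero : ∀ x < 0, f x = 0 := fun x hx => by
    rw [hf]
    simp only
    rw [h0 _ ((div_neg_of_neg_of_pos hx hε).le.trans hr.le), Complex.ofReal_zero, zero_mul]
  have hfs : ContDiff ℝ ∞ f := by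
    have h2 : ContDiff ℝ ∞ (fun x => (χ (x / ε) : ℂ)) :=
      Complex.ofRealCLM.contDiff.comp (hχ.smooth.comp (contDiff_id.div_const ε))
    exact h2.mul hh.smooth
  let θ : 𝓢(ℝ, ℂ) :=
    { toFun := f
      smooth' := hfs
      decay' := fun k m => by
        obtain ⟨C, hC⟩ := hh.decay m k
        obtain ⟨C', hC'⟩ := (isCompact_Icc (a := (0 : ℝ)) (b := max (R * ε) 0)
          ).exists_bound_of_continuousOn (f := fun x => ‖x‖ ^ k * ‖iteratedDeriv m f x‖)
          (((continuous_norm.pow k).mul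
            ((hfs.continuous_iteratedDeriv m (by exact_mod_cast le_top)).norm)).continuousOn)
        refine ⟨max (max C C') 0, fun x => ?_⟩
        rw [norm_iteratedFDeriv_eq_norm_iteratedDeriv]
        rcases lt_or_ge x 0 with hx | hx
        · have h3 : f =ᶠ[𝓝 x] fun _ => 0 := by
            filter_upwards [Iio_mem_nhds hx] with y hy using hzero y hy
          have h4 : iteratedDeriv m f x = 0 := by
            rw [h3.iteratedDeriv_eq m, iteratedDeriv_const]; split_ifs <;> rfl
          rw [h4, norm_zero, mul_zero]
          exact le_max_right _ _
        rcases le_or_gt x (max (R * ε) 0) with hx' | hx'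
        · have := hC' x ⟨hx, hx'⟩
          rw [Real.norm_of_nonneg (by positivity)] at this
          exact this.trans ((le_max_right _ _).trans (le_max_left _ _))
        · have h3 : f =ᶠ[𝓝 x] h := by
            filter_upwards [Ioi_mem_nhds ((le_max_left _ _).trans_lt hx')] with y hy
            rw [hf]
            simp only
            rw [h1 _ ((le_div_iff₀ hε).mpr (le_of_lt hy)), Complex.ofReal_one, one_mul]
          rw [h3.iteratedDeriv_eq m]
          refine le_trans ?_ ((le_max_left C C').trans (le_max_left _ _))
          have hpow : ‖x‖ ^ k ≤ (1 + x) ^ k := by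
            rw [Real.norm_of_nonneg hx]; gcongr; linarith
          have hpos : 0 < (1 + x) ^ k := by positivity
          calc ‖x‖ ^ k * ‖iteratedDeriv m h x‖ ≤ (1 + x) ^ k * ‖iteratedDeriv m h x‖ := by gcongr
            _ ≤ (1 + x) ^ k * (C * ((1 + x) ^ k)⁻¹) := by gcongr; exact hC x hx
            _ = C := by field_simp }
  exact ⟨⟨θ, mem_lizorkinPlus_of_neg θ hzero⟩, rfl⟩

/-- No junk value occurs in `asTest` when the function is a test function. -/
theorem coe_asTest {h : ℝ → ℂ} (H : ∃ θ : lizorkinPlus, ((θ : 𝓢(ℝ, ℂ)) : ℝ → ℂ) = h) :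
    ((asTest h : 𝓢(ℝ, ℂ)) : ℝ → ℂ) = h := by
  rw [asTest, dif_pos H]
  exact H.choose_spec

theorem hasDerivAt_cutoff_mul {χ : ℝ → ℝ} (hχ : IsCutoff χ) {h : ℝ → ℂ} (hh : IsRapid h)
    (ε x : ℝ) :
    HasDerivAt (fun x => (χ (x / ε) : ℂ) * h x)
      ((ε⁻¹ : ℂ) * ((deriv χ (x / ε) : ℝ) : ℂ) * h x + (χ (x / ε) : ℂ) * deriv h x) x := by
  have h1 : HasDerivAt (fun x => χ (x / ε)) (deriv χ (x / ε) * (1 / ε)) x :=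
    ((hχ.smooth.differentiable (by simp)).differentiableAt.hasDerivAt).comp x
      ((hasDerivAt_id x).div_const ε)
  have h2 := h1.ofReal_comp.mul (hh.smooth.differentiable (by simp) x).hasDerivAt
  convert! h2 using 1
  push_cast
  ring

/-- The finite part of `⟨K v, (χ(·/ε) h)'⟩`: the cutoff contributes only a multiple of
`ε ^ (v - 1)`. -/
theorem hasFinitePart_weyl_deriv_cutoff_mul {v : ℂ} (hv : 0 < v.re) (hv1 : v ≠ 1) {χ : ℝ → ℝ}
    (hχ : IsCutoff χ) {h : ℝ → ℂ} (hh : IsRapid h) :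
    HasFinitePart (fun ε => weyl v (deriv fun x => (χ (x / ε) : ℂ) * h x) 0)
      (weyl v (deriv h) 0) := by
  obtain ⟨R, h1⟩ := hχ.one_far
  obtain ⟨M, hM⟩ := hχ.bounded
  have hχc : Continuous χ := hχ.smooth.continuous
  have hχ'c : Continuous (deriv χ) := hχ.smooth.continuous_deriv (by simp)
  have hhc : Continuous h := hh.smooth.continuous
  have hh'c : Continuous (deriv h) := hh.smooth.continuous_deriv (by simp)
  obtain ⟨C, hC⟩ := hh.decay 1 (decayExp v)
  rw [iteratedDeriv_one] at hC
  obtain ⟨L, hL⟩ := hh.decay 1 0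
  rw [iteratedDeriv_one] at hL
  simp only [pow_zero, inv_one, mul_one] at hL
  have hLip : ∀ x, 0 ≤ x → ‖h x - h 0‖ ≤ L * x := fun x hx => by
    have := (convex_Ici (0 : ℝ)).norm_image_sub_le_of_norm_deriv_le
      (fun y _ => hh.smooth.differentiable (by simp) y) (fun y hy => hL y hy)
      (self_mem_Ici (a := (0 : ℝ))) (show x ∈ Ici 0 from hx)
    rwa [sub_zero, Real.norm_of_nonneg hx] at this
  -- any continuous factor may accompany the compactly supported derivative of the cutoff
  have hcpt : ∀ g : ℝ → ℂ, Continuous g →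
      IntegrableOn (fun y => K v y * (((deriv χ y : ℝ) : ℂ) * g y)) (Ioi 0) := fun g hg => by
    have hs : HasCompactSupport (fun y : ℝ => ((deriv χ y : ℝ) : ℂ) * g y) := by
      have h3 : HasCompactSupport (fun y : ℝ => ((deriv χ y : ℝ) : ℂ)) :=
        hχ.hasCompactSupport_deriv.comp_left Complex.ofReal_zero
      exact h3.mul_right
    have hcont : Continuous (fun y : ℝ => ((deriv χ y : ℝ) : ℂ) * g y) := by fun_prop
    have hs2 : HasCompactSupport
        (fun y : ℝ => ((1 + y : ℝ) : ℂ) ^ decayExp v * (((deriv χ y : ℝ) : ℂ) * g y)) := hs.mul_left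
    obtain ⟨C', hC'⟩ := hs2.exists_bound_of_continuous (by fun_prop)
    refine integrableOn_K_mul hv hcont.measurable (C := C') fun y hy => ?_
    have h3 := hC' y
    rw [norm_mul, norm_pow, Complex.norm_real, Real.norm_of_nonneg (by linarith)] at h3
    rw [← div_eq_mul_inv, le_div_iff₀ (by positivity), mul_comm]
    exact h3
  have hI1 : ∀ ε : ℝ, IntegrableOn (fun y => K v y * ((χ (y / ε) : ℂ) * deriv h y)) (Ioi 0) :=
    fun ε => integrableOn_K_mul hv (C := M * C)
      (Continuous.measurable (by fun_prop)) fun y hy => by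
        rw [norm_mul, Complex.norm_real, Real.norm_eq_abs, mul_assoc]
        exact mul_le_mul (hM _) (hC y (le_of_lt hy)) (norm_nonneg _)
          ((abs_nonneg _).trans (hM 0))
  have hlim1 : Tendsto (fun ε : ℝ => ∫ y in Ioi (0 : ℝ), K v y * ((χ (y / ε) : ℂ) * deriv h y))
      (𝓝[>] 0) (𝓝 (weyl v (deriv h) 0)) := by
    refine tendsto_integral_filter_of_dominated_convergence
      (fun y => M * C * (‖K v y‖ * ((1 + y) ^ decayExp v)⁻¹))
      (Eventually.of_forall fun ε => (hI1 ε).aestronglyMeasurable) ?_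
      ((integrableOn_norm_K_mul hv).const_mul _) ?_
    · refine Eventually.of_forall fun ε => ?_
      filter_upwards [ae_restrict_mem measurableSet_Ioi] with y hy
      have hy' : 0 < y := hy
      rw [norm_mul, norm_mul, Complex.norm_real, Real.norm_eq_abs]
      calc ‖K v y‖ * (|χ (y / ε)| * ‖deriv h y‖)
          ≤ ‖K v y‖ * (M * (C * ((1 + y) ^ decayExp v)⁻¹)) := by
            gcongr
            · exact (abs_nonneg _).trans (hM 0)
            · exact hM _
            · exact hC y hy'.le
        _ = _ := by ring
    · filter_upwards [ae_restrict_mem measurableSet_Ioi] with y hy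
      have hy' : 0 < y := hy
      refine tendsto_const_nhds.congr' ?_
      have hev : ∀ᶠ ε : ℝ in 𝓝[>] 0, ε < y / (|R| + 1) :=
        nhdsWithin_le_nhds (Iio_mem_nhds (by positivity))
      filter_upwards [hev, self_mem_nhdsWithin] with ε hε hε0
      have hε0' : 0 < ε := hε0
      rw [h1 (y / ε), Complex.ofReal_one, one_mul, zero_add]
      rw [lt_div_iff₀ (by positivity)] at hε
      rw [ge_iff_le, le_div_iff₀ hε0']
      nlinarith [le_abs_self R]
  -- the coefficient of the divergent term comes from replacing `h` by its value at the origin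
  set A : ℂ := h 0 * ∫ s in Ioi (0 : ℝ), K v s * ((deriv χ s : ℝ) : ℂ) with hA
  have hI2 : ∀ ε : ℝ, 0 < ε →
      ∫ y in Ioi (0 : ℝ), K v y * ((ε⁻¹ : ℂ) * ((deriv χ (y / ε) : ℝ) : ℂ) * h y)
        = (ε : ℂ) ^ (v - 1) * ∫ s in Ioi (0 : ℝ), K v s * (((deriv χ s : ℝ) : ℂ) * h (ε * s)) := by
    intro ε hε
    have hεc : (ε : ℂ) ≠ 0 := by exact_mod_cast hε.ne'
    have h3 := integral_comp_mul_left_Ioi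
      (fun y => K v y * ((ε⁻¹ : ℂ) * ((deriv χ (y / ε) : ℝ) : ℂ) * h y)) 0 hε
    rw [mul_zero] at h3
    have h4 : ∫ y in Ioi (0 : ℝ), K v y * ((ε⁻¹ : ℂ) * ((deriv χ (y / ε) : ℝ) : ℂ) * h y)
        = (ε : ℂ) * ∫ s in Ioi (0 : ℝ), K v (ε * s) *
          ((ε⁻¹ : ℂ) * ((deriv χ (ε * s / ε) : ℝ) : ℂ) * h (ε * s)) := by
      rw [h3, Complex.real_smul, Complex.ofReal_inv, mul_inv_cancel_left₀ hεc]
    rw [h4, ← integral_const_mul, ← integral_const_mul]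
    refine setIntegral_congr_fun measurableSet_Ioi fun s hs => ?_
    have hs' : 0 < s := hs
    simp only [K, if_pos hs', if_pos (mul_pos hε hs'), mul_div_cancel_left₀ s hε.ne']
    push_cast
    rw [Complex.mul_cpow_ofReal_nonneg hε.le hs'.le]
    field_simp
  have hlim2 : Tendsto (fun ε : ℝ =>
      (∫ y in Ioi (0 : ℝ), K v y * ((ε⁻¹ : ℂ) * ((deriv χ (y / ε) : ℝ) : ℂ) * h y))
        - A * (ε : ℂ) ^ (v - 1)) (𝓝[>] 0) (𝓝 0) := by
    set J : ℝ := ∫ s in Ioi (0 : ℝ), ‖K v s * (((deriv χ s : ℝ) : ℂ) * (s : ℂ))‖ with hJ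
    have hbig : Tendsto (fun ε : ℝ => L * J * ε ^ v.re) (𝓝[>] 0) (𝓝 0) := by
      have h3 : Tendsto (fun ε : ℝ => ε ^ v.re) (𝓝 0) (𝓝 ((0 : ℝ) ^ v.re)) :=
        (Real.continuousAt_rpow_const 0 v.re (Or.inr hv.le)).tendsto
      rw [Real.zero_rpow hv.ne'] at h3
      simpa using (h3.mono_left nhdsWithin_le_nhds).const_mul (L * J)
    refine squeeze_zero_norm' ?_ hbig
    filter_upwards [self_mem_nhdsWithin] with ε hε
    have hε' : 0 < ε := hε
    have hi1 := hcpt (fun s => h (ε * s)) (by fun_prop)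
    have hi2 := hcpt (fun _ => h 0) (by fun_prop)
    have h3 : (∫ s in Ioi (0 : ℝ), K v s * (((deriv χ s : ℝ) : ℂ) * h (ε * s))) - A
        = ∫ s in Ioi (0 : ℝ), K v s * (((deriv χ s : ℝ) : ℂ) * (h (ε * s) - h 0)) := by
      rw [hA, ← integral_const_mul]
      have : (fun s : ℝ => h 0 * (K v s * ((deriv χ s : ℝ) : ℂ)))
          = fun s => K v s * (((deriv χ s : ℝ) : ℂ) * h 0) := by ext s; ring
      rw [this, ← integral_sub hi1 hi2]
      congr 1; ext s; ring
    rw [hI2 ε hε', mul_comm A, ← mul_sub, h3, norm_mul, Complex.norm_cpow_eq_rpow_re_of_pos hε']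
    have h4 : ‖∫ s in Ioi (0 : ℝ), K v s * (((deriv χ s : ℝ) : ℂ) * (h (ε * s) - h 0))‖
        ≤ ε * L * J := by
      rw [hJ, ← integral_const_mul]
      refine norm_integral_le_of_norm_le ((hcpt _ Complex.continuous_ofReal).norm.const_mul _) ?_
      filter_upwards [ae_restrict_mem measurableSet_Ioi] with s hs
      have hs' : 0 < s := hs
      have h5 := hLip (ε * s) (by positivity)
      rw [norm_mul, norm_mul, norm_mul, norm_mul, Complex.norm_real s, Real.norm_of_nonneg hs'.le]
      calc ‖K v s‖ * (‖((deriv χ s : ℝ) : ℂ)‖ * ‖h (ε * s) - h 0‖)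
          ≤ ‖K v s‖ * (‖((deriv χ s : ℝ) : ℂ)‖ * (L * (ε * s))) := by gcongr
        _ = _ := by ring
    calc ε ^ (v - 1).re * ‖_‖ ≤ ε ^ (v - 1).re * (ε * L * J) := by gcongr
      _ = L * J * (ε ^ (v - 1).re * ε ^ (1 : ℝ)) := by rw [Real.rpow_one]; ring
      _ = L * J * ε ^ v.re := by rw [← Real.rpow_add hε']; simp
  refine ⟨{v - 1}, fun _ => A, 0, 
    fun h0 => hv1 (sub_eq_zero.mp (Finset.mem_singleton.mp h0).symm), ?_⟩
  have hsum := hlim2.add hlim1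
  rw [zero_add] at hsum
  refine hsum.congr' ?_
  filter_upwards [self_mem_nhdsWithin] with ε hε
  have hε' : 0 < ε := hε
  have hi : IntegrableOn
      (fun y => K v y * ((ε⁻¹ : ℂ) * ((deriv χ (y / ε) : ℝ) : ℂ) * h y)) (Ioi 0) := by
    have h3 := (hcpt (fun s => h (ε * s)) (by fun_prop))
    have h4 := (integrableOn_Ioi_comp_mul_left_iff
      (fun y => K v y * ((ε⁻¹ : ℂ) * ((deriv χ (y / ε) : ℝ) : ℂ) * h y)) 0 hε')
    rw [mul_zero] at h4
    refine h4.mp (IntegrableOn.congr_fun (h3.const_mul ((ε : ℂ) ^ (v - 1) * (ε : ℂ)⁻¹))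
      (fun s hs => ?_) measurableSet_Ioi)
    have hs' : 0 < s := hs
    simp only [K, if_pos hs', if_pos (mul_pos hε' hs'), mul_div_cancel_left₀ s hε'.ne']
    push_cast
    rw [Complex.mul_cpow_ofReal_nonneg hε'.le hs'.le]
    ring
  have hderiv : weyl v (deriv fun x => (χ (x / ε) : ℂ) * h x) 0
      = (∫ y in Ioi (0 : ℝ), K v y * ((ε⁻¹ : ℂ) * ((deriv χ (y / ε) : ℝ) : ℂ) * h y))
        + ∫ y in Ioi (0 : ℝ), K v y * ((χ (y / ε) : ℂ) * deriv h y) := by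
    rw [← integral_add hi (hI1 ε), weyl]
    congr 1; ext y
    rw [(hasDerivAt_cutoff_mul hχ hh ε (0 + y)).deriv, zero_add, mul_add]
  rw [hderiv]
  simp only [Finset.sum_singleton, zero_mul, sub_zero]
  ring

/-! ### The inner function of the convolution -/

/-- The inner function of the convolution, in one formula for `Re w = 0` and `Re w > 0`. -/
theorem kernelPairing_eq {w : ℂ} (hw0 : 0 ≤ w.re) (hw1 : w.re < 1) (φ : 𝓢(ℝ, ℂ)) (x : ℝ) :
    (kernelPairing w fun y => φ (x + y)) = -weyl (w + 1) (schwartzDeriv φ) x := by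
  rcases hw0.eq_or_lt with h | h
  · have hn : (⌊-w.re⌋ + 1).toNat = 1 := by rw [← h]; simp
    have h1 : iteratedDeriv 1 (fun y => φ (x + y)) = fun y => schwartzDeriv φ (x + y) := by
      rw [iteratedDeriv_one]
      ext y
      exact ((hasDerivAt_schwartz φ (x + y)).comp_const_add x y).deriv
    rw [kernelPairing, hn, h1, weyl]
    simp
  · have hf : ⌊-w.re⌋ = -1 := by
      rw [Int.floor_eq_iff]; constructor <;> push_cast <;> linarith
    rw [weyl_add_one_deriv h, neg_neg, kernelPairing, hf, weyl]
    simp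

theorem deriv_neg_weyl {w : ℂ} (hw0 : 0 ≤ w.re) (φ : 𝓢(ℝ, ℂ)) :
    deriv (fun x => -weyl (w + 1) (schwartzDeriv φ) x)
      = fun x => -weyl (w + 1) (schwartzDeriv (schwartzDeriv φ)) x := by
  ext x
  exact (hasDerivAt_weyl (by simp; linarith) _ x).neg.deriv

/-- The kernels `K (1 - w)` and `K (w + 1)` are inverse to each other up to two derivatives. -/
theorem weyl_deriv_neg_weyl {w : ℂ} (hw0 : 0 ≤ w.re) (hw1 : w.re < 1) (φ : 𝓢(ℝ, ℂ)) (x : ℝ) :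
    weyl (1 - w) (deriv fun x => -weyl (w + 1) (schwartzDeriv φ) x) x = -φ x := by
  rw [deriv_neg_weyl hw0]
  have h1 := weyl_weyl (a := 1 - w) (b := w + 1) (by simp; linarith) (by simp; linarith)
    (schwartzDeriv (schwartzDeriv φ)) x
  rw [show 1 - w + (w + 1) = 1 + 1 by ring, weyl_add_one_deriv (by simp), weyl_one_deriv,
    neg_neg] at h1
  rw [← h1]
  simp [weyl, integral_neg]

/-! ### Multiplication by the exponential is injective on the dual -/

theorem IsCutoff.iteratedDeriv_bounded {χ : ℝ → ℝ} (hχ : IsCutoff χ) (i : ℕ) :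
    ∃ M : ℝ, 0 ≤ M ∧ ∀ x, ‖iteratedDeriv i χ x‖ ≤ M := by
  rcases Nat.eq_zero_or_pos i with rfl | hi
  · obtain ⟨M, hM⟩ := hχ.bounded
    exact ⟨M, (abs_nonneg _).trans (hM 0), fun x => by
      rw [iteratedDeriv_zero, Real.norm_eq_abs]; exact hM x⟩
  · obtain ⟨j, rfl⟩ := Nat.exists_eq_succ_of_ne_zero hi.ne'
    have hs : HasCompactSupport (iteratedDeriv (j + 1) χ) := by
      rw [iteratedDeriv_succ']
      have h1 := hχ.hasCompactSupport_deriv.iteratedFDeriv (𝕜 := ℝ) j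
      refine h1.mono fun x hx => ?_
      rw [Function.mem_support] at hx ⊢
      contrapose! hx
      rw [← norm_eq_zero, ← norm_iteratedFDeriv_eq_norm_iteratedDeriv, hx, norm_zero]
    obtain ⟨M, hM⟩ := hs.exists_bound_of_continuous
      (hχ.smooth.continuous_iteratedDeriv (j + 1) (by exact_mod_cast le_top))
    exact ⟨M, (norm_nonneg _).trans (hM 0), hM⟩

theorem isRapid_schwartz (φ : 𝓢(ℝ, ℂ)) : IsRapid φ where
  smooth := φ.smooth ⊤
  decay m k := by
    refine ⟨2 ^ k * (Finset.Iic (k, m)).sup (fun m => SchwartzMap.seminorm ℂ m.1 m.2) φ,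
      fun x hx => ?_⟩
    have h := SchwartzMap.one_add_le_sup_seminorm_apply (𝕜 := ℂ) (m := (k, m)) (k := k) (n := m)
      le_rfl le_rfl φ x
    rw [norm_iteratedFDeriv_eq_norm_iteratedDeriv, Real.norm_of_nonneg hx] at h
    rw [← div_eq_mul_inv, le_div_iff₀ (by positivity), mul_comm]
    exact h

/-- Cutting off a test function near the origin at growing scales gives a null sequence. -/
theorem tendsto_cutoff_mul_zero {χ : ℝ → ℝ} (hχ : IsCutoff χ) (φ : lizorkinPlus)
    (θ : ℕ → lizorkinPlus)
    (hθ : ∀ n, ((θ n : 𝓢(ℝ, ℂ)) : ℝ → ℂ)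
      = fun x => (χ (x / ((n : ℝ) + 1)) : ℂ) * (φ : 𝓢(ℝ, ℂ)) x) :
    Tendsto θ atTop (𝓝 0) := by
  rw [tendsto_subtype_rng, (schwartz_withSeminorms ℂ ℝ ℂ).tendsto_nhds]
  rintro ⟨k, m⟩ δ hδ
  obtain ⟨r, hr, h0⟩ := hχ.zero_near
  choose M hM0 hM using hχ.iteratedDeriv_bounded
  set S : ℝ := ∑ i ∈ Finset.range (m + 1), (m.choose i : ℝ) * M i *
    SchwartzMap.seminorm ℂ (k + 1) (m - i) (φ : 𝓢(ℝ, ℂ)) with hS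
  have hS0 : 0 ≤ S := Finset.sum_nonneg fun i _ => by
    have := hM0 i
    positivity
  have hbound : ∀ n : ℕ, SchwartzMap.seminorm ℂ k m (θ n : 𝓢(ℝ, ℂ)) ≤ S / (r * ((n : ℝ) + 1)) := by
    intro n
    have hn : (0 : ℝ) < (n : ℝ) + 1 := by positivity
    refine SchwartzMap.seminorm_le_bound ℂ k m _ (by positivity) fun x => ?_
    rw [hθ n]
    set g : ℝ → ℂ := fun x => (χ (x / ((n : ℝ) + 1)) : ℂ) with hg
    have hgs : ContDiff ℝ ∞ g :=
      Complex.ofRealCLM.contDiff.comp (hχ.smooth.comp (contDiff_id.div_const _))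
    have hgb : ∀ i, ‖iteratedFDeriv ℝ i g x‖ ≤ M i := fun i => by
      have h1 : ‖iteratedFDeriv ℝ i g x‖
          = ‖iteratedFDeriv ℝ i (fun x => χ (x / ((n : ℝ) + 1))) x‖ := by
        exact Complex.ofRealLI.norm_iteratedFDeriv_comp_left
          ((hχ.smooth.comp (contDiff_id.div_const _)).contDiffAt) (by exact_mod_cast le_top)
      rw [h1, norm_iteratedFDeriv_eq_norm_iteratedDeriv]
      have h2 : (fun x => χ (x / ((n : ℝ) + 1))) = fun x => χ (((n : ℝ) + 1)⁻¹ * x) := by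
        ext x; rw [div_eq_inv_mul]
      rw [h2, iteratedDeriv_comp_const_mul (hχ.smooth.of_le (by exact_mod_cast le_top))]
      simp only [norm_mul, norm_pow, norm_inv, Real.norm_of_nonneg hn.le]
      calc (((n : ℝ) + 1)⁻¹) ^ i * ‖iteratedDeriv i χ (((n : ℝ) + 1)⁻¹ * x)‖
          ≤ 1 * M i := by
            gcongr
            · exact pow_le_one₀ (by positivity)
                (inv_le_one_of_one_le₀ (by linarith [n.cast_nonneg (α := ℝ)]))
            · exact hM i _
        _ = M i := one_mul _
    rcases lt_or_ge x (r * ((n : ℝ) + 1)) with hx | hx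
    · have h3 : (fun x => g x * (φ : 𝓢(ℝ, ℂ)) x) =ᶠ[𝓝 x] fun _ => 0 := by
        filter_upwards [Iio_mem_nhds hx] with y hy
        rw [hg]
        simp only
        rw [h0 _ ((div_le_iff₀ hn).mpr (le_of_lt hy)), Complex.ofReal_zero, zero_mul]
      have h4 : iteratedFDeriv ℝ m (fun x => g x * (φ : 𝓢(ℝ, ℂ)) x) x = 0 := by
        rw [(h3.iteratedFDeriv ℝ m).eq_of_nhds]
        exact congrFun (iteratedFDeriv_fun_zero (𝕜 := ℝ) (E := ℝ) (F := ℂ) (n := m)) x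
      rw [h4, norm_zero, mul_zero]
      positivity
    -- on the support of the cutoff, one more power of `x` gains the factor `1 / (r (n + 1))`
    · have hrn : 0 < r * ((n : ℝ) + 1) := by positivity
      have hx0 : 0 < x := hrn.trans_le hx
      have h5 := norm_iteratedFDeriv_mul_le (n := m) hgs ((φ : 𝓢(ℝ, ℂ)).smooth ⊤) x
        (by exact_mod_cast le_top)
      rw [le_div_iff₀ hrn]
      calc ‖x‖ ^ k * ‖iteratedFDeriv ℝ m (fun x => g x * (φ : 𝓢(ℝ, ℂ)) x) x‖ * (r * ((n : ℝ) + 1))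
          ≤ ‖x‖ ^ k * (∑ i ∈ Finset.range (m + 1), (m.choose i : ℝ) * ‖iteratedFDeriv ℝ i g x‖ *
              ‖iteratedFDeriv ℝ (m - i) (φ : 𝓢(ℝ, ℂ)) x‖) * ‖x‖ := by
            rw [Real.norm_of_nonneg hx0.le] at *
            gcongr
        _ = ∑ i ∈ Finset.range (m + 1), (m.choose i : ℝ) * ‖iteratedFDeriv ℝ i g x‖ *
              (‖x‖ ^ (k + 1) * ‖iteratedFDeriv ℝ (m - i) (φ : 𝓢(ℝ, ℂ)) x‖) := by
            rw [mul_right_comm, ← pow_succ, Finset.mul_sum]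
            refine Finset.sum_congr rfl fun i _ => by ring
        _ ≤ S := by
            refine Finset.sum_le_sum fun i _ => ?_
            gcongr
            · exact mul_nonneg (Nat.cast_nonneg _) (hM0 i)
            · exact hgb i
            · exact SchwartzMap.le_seminorm ℂ _ _ _ x
  obtain ⟨n₀, hn₀⟩ := exists_nat_gt (S / (r * δ))
  filter_upwards [eventually_ge_atTop n₀] with n hn
  have h6 : ((0 : lizorkinPlus) : 𝓢(ℝ, ℂ)) = 0 := rfl
  rw [h6, sub_zero]
  refine (hbound n).trans_lt ?_
  have hn' : (n₀ : ℝ) ≤ n := by exact_mod_cast hn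
  rw [div_lt_iff₀ (by positivity)] at hn₀ ⊢
  nlinarith [mul_pos hr hδ]

theorem expMul_injective (a : ℝ≥0) : Function.Injective (expMul a) := by
  rw [injective_iff_map_eq_zero]
  intro u hu
  ext φ
  obtain ⟨χ, hχ⟩ := exists_isCutoff
  obtain ⟨R, h1⟩ := hχ.one_far
  choose θ hθ using fun n : ℕ => exists_cutoff_mul hχ (isRapid_schwartz (φ : 𝓢(ℝ, ℂ)))
    (show (0 : ℝ) < (n : ℝ) + 1 by positivity)
  -- the difference `φ - θ n` has compact support, so it can be divided by the exponential
  have hdiff : ∀ n, u (φ - θ n) = 0 := fun n => by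
    have hn : (0 : ℝ) < (n : ℝ) + 1 := by positivity
    set g : ℝ → ℂ := fun x => (Real.exp ((a : ℝ) * x) : ℂ) * (φ - θ n : 𝓢(ℝ, ℂ)) x with hg
    have hval : ∀ x, (φ - θ n : 𝓢(ℝ, ℂ)) x = (φ : 𝓢(ℝ, ℂ)) x
        - (χ (x / ((n : ℝ) + 1)) : ℂ) * (φ : 𝓢(ℝ, ℂ)) x := fun x => by
      rw [sub_apply, hθ n]
    have hgs : ContDiff ℝ ∞ g :=
      (Complex.ofRealCLM.contDiff.comp
        (Real.contDiff_exp.comp (contDiff_const.mul contDiff_id))).mul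
        ((φ - θ n : 𝓢(ℝ, ℂ)).smooth ⊤)
    have hgc : HasCompactSupport g := by
      refine HasCompactSupport.intro (isCompact_Icc (a := 0) (b := R * ((n : ℝ) + 1)))
        fun x hx => ?_
      rw [hg]
      simp only
      rw [hval]
      rcases lt_or_ge x 0 with hx0 | hx0
      · rw [lizorkinPlus_eq_zero_of_neg φ hx0]; simp
      · have hx1 : R * ((n : ℝ) + 1) < x := by by_contra h; exact hx ⟨hx0, not_lt.mp h⟩
        rw [h1 _ ((le_div_iff₀ hn).mpr hx1.le)]; simp
    have hmem : hgc.toSchwartzMap hgs ∈ lizorkinPlus := mem_lizorkinPlus_of_neg _ fun x hx => by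
      change g x = 0
      rw [hg]
      simp only
      rw [hval, lizorkinPlus_eq_zero_of_neg φ hx]; simp
    have heq : expMulTest a ⟨hgc.toSchwartzMap hgs, hmem⟩ = φ - θ n := by
      ext x
      rw [expMulTest_apply]
      change _ * g x = _
      rw [hg]
      simp only
      rw [← mul_assoc, ← Complex.ofReal_mul, ← Real.exp_add]
      simp
    rw [← heq]
    exact DFunLike.congr_fun hu _
  have hlim : Tendsto (fun n => u (θ n)) atTop (𝓝 (u 0)) :=
    (u.continuous.tendsto 0).comp (tendsto_cutoff_mul_zero hχ φ θ hθ)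
  have hconst : ∀ n, u (θ n) = u φ := fun n => by
    have := hdiff n
    rw [map_sub, sub_eq_zero] at this
    exact this.symm
  simp only [hconst, map_zero] at hlim
  exact tendsto_nhds_unique tendsto_const_nhds hlim

theorem mem_expFracDeriv_graph_iff (a : ℝ≥0) (z : ℂ) (F G : LizorkinDual) :
    (F, G) ∈ (expFracDeriv a z).graph ↔
      ∃ f g : LizorkinDual, (f, g) ∈ (fracDeriv z).graph ∧
        F = expMul a f ∧ G = expMul a g := by
  rw [expFracDeriv, Submodule.toLinearPMap_graph_eq]
  · rw [Submodule.mem_map]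
    constructor
    · rintro ⟨⟨f, g⟩, h, he⟩
      rw [LinearMap.prodMap_apply, Prod.mk.injEq] at he
      exact ⟨f, g, h, he.1.symm, he.2.symm⟩
    · rintro ⟨f, g, h, rfl, rfl⟩
      exact ⟨(f, g), h, rfl⟩
  · rintro ⟨F, G⟩ h hF
    obtain ⟨⟨f, g⟩, h, he⟩ := Submodule.mem_map.mp h
    rw [LinearMap.prodMap_apply, Prod.mk.injEq] at he
    have hF' : F = 0 := hF
    have hf : f = 0 := expMul_injective a (by rw [he.1, hF', map_zero])
    have hg : g = 0 := (fracDeriv z).graph_fst_eq_zero_snd h hf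
    change G = 0
    rw [← he.2]
    change expMul a g = 0
    rw [hg, map_zero]

/-! ### Regular functionals and delta series -/

theorem integrableOn_inv_one_add_sq : IntegrableOn (fun y : ℝ => ((1 + y) ^ 2)⁻¹) (Ioi 0) := by
  refine (integrableOn_norm_K_mul (v := 1) (by simp)).congr_fun (fun y hy => ?_) measurableSet_Ioi
  have hy' : 0 < y := hy
  simp [norm_K hy', decayExp]

/-- A measurable function of polynomial growth on `(0, ∞)` defines an element of the dual. -/
theorem exists_isRegular {f : ℝ → ℂ} (hf : Measurable f) {C : ℝ} {N : ℕ}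
    (hC : ∀ x > 0, ‖f x‖ ≤ C * (1 + x) ^ N) : ∃ u : LizorkinDual, IsRegular u f := by
  set p : 𝓢(ℝ, ℂ) → ℝ := fun ψ => 2 ^ (N + 2) *
    (Finset.Iic (N + 2, 0)).sup (schwartzSeminormFamily ℂ ℝ ℂ) ψ with hp
  have hC0 : 0 ≤ C := by
    have := (norm_nonneg _).trans (hC 1 one_pos)
    exact nonneg_of_mul_nonneg_left this (by positivity)
  have hb : ∀ (ψ : 𝓢(ℝ, ℂ)), ∀ x > 0, ‖f x * ψ x‖ ≤ C * p ψ * ((1 + x) ^ 2)⁻¹ := by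
    intro ψ x hx
    have h := SchwartzMap.one_add_le_sup_seminorm_apply (𝕜 := ℂ) (m := (N + 2, 0)) (k := N + 2)
      (n := 0) le_rfl le_rfl ψ x
    rw [norm_iteratedFDeriv_zero, Real.norm_of_nonneg hx.le, pow_add] at h
    have hpos : 0 < (1 + x) ^ 2 := by positivity
    rw [norm_mul, ← div_eq_mul_inv, le_div_iff₀ hpos]
    calc ‖f x‖ * ‖ψ x‖ * (1 + x) ^ 2 ≤ C * (1 + x) ^ N * ‖ψ x‖ * (1 + x) ^ 2 := by
          gcongr; exact hC x hx
      _ = C * ((1 + x) ^ N * (1 + x) ^ 2 * ‖ψ x‖) := by ring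
      _ ≤ C * p ψ := by gcongr; exact h
  have hi : ∀ ψ : 𝓢(ℝ, ℂ), IntegrableOn (fun x => f x * ψ x) (Ioi 0) := fun ψ => by
    refine (integrableOn_inv_one_add_sq.const_mul (C * p ψ)).mono'
      (hf.mul ψ.continuous.measurable).aestronglyMeasurable ?_
    filter_upwards [ae_restrict_mem measurableSet_Ioi] with x hx using hb ψ x hx
  let T : 𝓢(ℝ, ℂ) →L[ℂ] ℂ := SchwartzMap.mkCLMtoNormedSpace
    (fun ψ => ∫ x in Ioi (0 : ℝ), f x * ψ x)
    (fun ψ θ => by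
      rw [← integral_add (hi ψ) (hi θ)]
      congr 1; ext x
      rw [add_apply, mul_add])
    (fun c ψ => by
      simp only [RingHom.id_apply, smul_eq_mul]
      rw [← integral_const_mul]
      congr 1; ext x
      rw [smul_apply, smul_eq_mul]; ring)
    ⟨Finset.Iic (N + 2, 0), C * 2 ^ (N + 2) * ∫ x in Ioi (0 : ℝ), ((1 + x) ^ 2)⁻¹,
      mul_nonneg (by positivity) (setIntegral_nonneg measurableSet_Ioi fun x hx => by
        have : (0 : ℝ) < x := hx
        positivity), fun ψ => by
      refine (norm_integral_le_of_norm_le (integrableOn_inv_one_add_sq.const_mul (C * p ψ))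
        ?_).trans (le_of_eq ?_)
      · filter_upwards [ae_restrict_mem measurableSet_Ioi] with x hx using hb ψ x hx
      · rw [integral_const_mul, hp]; ring⟩
  exact ⟨T.comp lizorkinPlus.subtypeL, fun φ => ⟨hi φ, rfl⟩⟩

theorem summable_inv_one_add_sq : Summable fun ℓ : ℕ => ((1 + (ℓ : ℝ)) ^ 2)⁻¹ := by
  have h := (summable_nat_add_iff 1).mpr (Real.summable_nat_pow_inv.mpr one_lt_two)
  refine h.congr fun ℓ => ?_
  push_cast
  rw [add_comm]

theorem exists_isDeltaSeries {c : ℕ → ℂ} {M : ℝ} (hM : ∀ ℓ, ‖c ℓ‖ ≤ M) :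
    ∃ G : LizorkinDual, IsDeltaSeries G c := by
  have hM0 : 0 ≤ M := (norm_nonneg _).trans (hM 0)
  set p : 𝓢(ℝ, ℂ) → ℝ := fun ψ => 2 ^ 2 *
    (Finset.Iic (2, 0)).sup (schwartzSeminormFamily ℂ ℝ ℂ) ψ with hp
  have hb : ∀ (ψ : 𝓢(ℝ, ℂ)) (ℓ : ℕ), ‖c ℓ * ψ ℓ‖ ≤ M * p ψ * ((1 + (ℓ : ℝ)) ^ 2)⁻¹ := by
    intro ψ ℓ
    have h := SchwartzMap.one_add_le_sup_seminorm_apply (𝕜 := ℂ) (m := (2, 0)) (k := 2)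
      (n := 0) le_rfl le_rfl ψ (ℓ : ℝ)
    rw [norm_iteratedFDeriv_zero, Real.norm_of_nonneg (Nat.cast_nonneg _)] at h
    rw [norm_mul, ← div_eq_mul_inv, le_div_iff₀ (by positivity), mul_assoc]
    refine mul_le_mul (hM ℓ) ?_ (by positivity) hM0
    rw [mul_comm]
    exact h
  have hs : ∀ ψ : 𝓢(ℝ, ℂ), Summable fun ℓ : ℕ => c ℓ * ψ ℓ := fun ψ =>
    Summable.of_norm_bounded (summable_inv_one_add_sq.mul_left (M * p ψ)) (hb ψ)
  let T : 𝓢(ℝ, ℂ) →L[ℂ] ℂ := SchwartzMap.mkCLMtoNormedSpace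
    (fun ψ => ∑' ℓ : ℕ, c ℓ * ψ ℓ)
    (fun ψ θ => by
      rw [← (hs ψ).tsum_add (hs θ)]
      congr 1; ext ℓ
      rw [add_apply, mul_add])
    (fun k ψ => by
      simp only [RingHom.id_apply, smul_eq_mul]
      rw [← tsum_mul_left]
      congr 1; ext ℓ
      rw [smul_apply, smul_eq_mul]; ring)
    ⟨Finset.Iic (2, 0), M * 2 ^ 2 * ∑' ℓ : ℕ, ((1 + (ℓ : ℝ)) ^ 2)⁻¹,
      mul_nonneg (by positivity) (tsum_nonneg fun ℓ => by positivity), fun ψ => by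
      refine (tsum_of_norm_bounded (summable_inv_one_add_sq.mul_left (M * p ψ)).hasSum
        (hb ψ)).trans (le_of_eq ?_)
      rw [tsum_mul_left, hp]; ring⟩
  exact ⟨T.comp lizorkinPlus.subtypeL, fun φ => (hs φ).hasSum⟩

theorem IsRegular.expMul {u : LizorkinDual} {f : ℝ → ℂ} (h : IsRegular u f) (a : ℝ≥0) :
    IsRegular (expMul a u) (fun x => f x * (Real.exp (-(a : ℝ) * x) : ℂ)) := fun φ => by
  have h1 := h (expMulTest a φ)
  simp only [expMulTest_apply, ← mul_assoc] at h1
  exact h1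

theorem IsRegular.congr {u : LizorkinDual} {f g : ℝ → ℂ} (h : IsRegular u f)
    (hfg : EqOn f g (Ioi 0)) : IsRegular u g := fun φ => by
  have he : EqOn (fun x => f x * (φ : 𝓢(ℝ, ℂ)) x) (fun x => g x * (φ : 𝓢(ℝ, ℂ)) x) (Ioi 0) :=
    fun x hx => by simp only [hfg hx]
  rw [← setIntegral_congr_fun measurableSet_Ioi he]
  exact ⟨(h φ).1.congr_fun he measurableSet_Ioi, (h φ).2⟩

theorem IsDeltaSeries.expMul {u : LizorkinDual} {c : ℕ → ℂ} (h : IsDeltaSeries u c) (a : ℝ≥0) :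
    IsDeltaSeries (expMul a u) (fun ℓ => c ℓ * (Real.exp (-(ℓ : ℝ) * (a : ℝ)) : ℂ)) := fun φ => by
  have h1 := h (expMulTest a φ)
  simp only [expMulTest_apply, ← mul_assoc] at h1
  have he : ∀ ℓ : ℕ, -(ℓ : ℝ) * (a : ℝ) = -(a : ℝ) * ℓ := fun ℓ => by ring
  simp only [he]
  exact h1

/-! ### The fractional derivative of series of truncated powers -/

theorem coe_derivTest_iterate (θ : lizorkinPlus) (n : ℕ) :
    (((derivTest^[n]) θ : lizorkinPlus) : 𝓢(ℝ, ℂ)) = schwartzDeriv^[n] (θ : 𝓢(ℝ, ℂ)) := by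
  induction n generalizing θ with
  | zero => rfl
  | succ n ih => rw [Function.iterate_succ_apply, ih, Function.iterate_succ_apply]; rfl

theorem weakDeriv_pow_apply (u : LizorkinDual) (n : ℕ) (θ : lizorkinPlus) :
    (weakDeriv ^ n) u θ = (-1) ^ n * u (derivTest^[n] θ) := by
  induction n generalizing u with
  | zero => simp
  | succ n ih =>
    rw [pow_succ, Module.End.mul_apply, ih, Function.iterate_succ_apply', pow_succ]
    change (-1) ^ n * -(u (derivTest (derivTest^[n] θ))) = _
    ring

theorem weyl_add_natCast_deriv {v : ℂ} (hv : 0 < v.re) (k : ℕ) (ψ : 𝓢(ℝ, ℂ)) (x : ℝ) :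
    weyl (v + k) (schwartzDeriv^[k] ψ) x = (-1) ^ k * weyl v ψ x := by
  induction k with
  | zero => simp
  | succ k ih =>
    have h : 0 < (v + k).re := by simp; positivity
    rw [Function.iterate_succ_apply', Nat.cast_succ, ← add_assoc, weyl_add_one_deriv h, ih,
      pow_succ]
    ring

/-- If `u` is a series of translates of `K z`, then `D ^ z u` is the corresponding series of
translates of the Dirac distribution: on `(0, ∞)` this is the inversion formula for Weyl
integrals, and the term at the origin has finite part zero. -/
theorem mem_fracDeriv_graph_of_hasSum {z : ℂ} (hz : 1 < z.re) {c : ℕ → ℂ} {u G : LizorkinDual}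
    (hu : ∀ θ : lizorkinPlus, HasSum (fun ℓ : ℕ => c ℓ * weyl z (θ : 𝓢(ℝ, ℂ)) ℓ) (u θ))
    (hG : IsDeltaSeries G c) : (u, G) ∈ (fracDeriv z).graph := by
  rw [mem_fracDeriv_graph_iff]
  set n := ⌈z.re⌉₊ with hn
  set w : ℂ := (n : ℂ) - z with hw
  have hn0 : 0 < n := Nat.ceil_pos.mpr (by linarith)
  have hw0 : 0 ≤ w.re := by
    have := Nat.le_ceil z.re
    simp [hw, hn]; exact this
  have hw1 : w.re < 1 := by
    have := Nat.ceil_lt_add_one (show 0 ≤ z.re by linarith)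
    simp [hw, hn]; linarith
  have hv : 0 < (1 - w).re := by simp; linarith
  intro φ χ hχ
  set h : ℝ → ℂ := fun x => -weyl (w + 1) (schwartzDeriv (φ : 𝓢(ℝ, ℂ))) x with hh
  have hrap : IsRapid h := (isRapid_weyl (by simp; linarith) _).neg
  have hinner : (fun x => kernelPairing w fun y => (φ : 𝓢(ℝ, ℂ)) (x + y)) = h :=
    funext fun x => kernelPairing_eq hw0 hw1 _ x
  have hinner' : ∀ ε : ℝ, (fun x => (χ (x / ε) : ℂ) *
      kernelPairing w fun y => (φ : 𝓢(ℝ, ℂ)) (x + y)) = fun x => (χ (x / ε) : ℂ) * h x :=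
    fun ε => by rw [← hinner]
  simp only [hinner']
  have hφ0 : (φ : 𝓢(ℝ, ℂ)) 0 = 0 := by simpa using φ.2.1 0
  -- `n - 1` derivatives are moved to the kernel, which turns `K z` into `K (1 - w)`
  have hDn : ∀ θ : lizorkinPlus,
      HasSum (fun ℓ : ℕ => c ℓ * -weyl (1 - w) (schwartzDeriv (θ : 𝓢(ℝ, ℂ))) ℓ)
        ((weakDeriv ^ n) u θ) := fun θ => by
    rw [weakDeriv_pow_apply]
    have h1 := (hu (derivTest^[n] θ)).mul_left ((-1) ^ n)
    convert! h1 using 1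
    ext ℓ
    obtain ⟨k, hk⟩ := Nat.exists_eq_succ_of_ne_zero hn0.ne'
    have hzk : z = 1 - w + k := by rw [hw, hk]; push_cast; ring
    rw [coe_derivTest_iterate, hk, Function.iterate_succ_apply]
    have hwk := weyl_add_natCast_deriv hv k (schwartzDeriv (θ : 𝓢(ℝ, ℂ))) ℓ
    rw [← hzk] at hwk
    rw [hwk, Nat.succ_eq_add_one, pow_succ]
    have : ((-1 : ℂ) ^ k) * (-1) ^ k = 1 := by rw [← mul_pow]; simp
    linear_combination (c ℓ * weyl (1 - w) (schwartzDeriv (θ : 𝓢(ℝ, ℂ))) ℓ) * this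
  -- for small `ε` the cutoff only affects the term at the origin
  have hsplit : ∀ᶠ ε : ℝ in 𝓝[>] 0, G φ + -c 0 *
      weyl (1 - w) (deriv fun x => (χ (x / ε) : ℂ) * h x) 0
        = (weakDeriv ^ n) u (asTest fun x => (χ (x / ε) : ℂ) * h x) := by
    obtain ⟨R, h1⟩ := hχ.one_far
    have hev : ∀ᶠ ε : ℝ in 𝓝[>] 0, ε < 1 / (|R| + 1) :=
      nhdsWithin_le_nhds (Iio_mem_nhds (by positivity))
    filter_upwards [hev, self_mem_nhdsWithin] with ε hε hε0
    have hε0' : 0 < ε := hε0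
    rw [lt_div_iff₀ (by positivity)] at hε
    have hsum := hDn (asTest fun x => (χ (x / ε) : ℂ) * h x)
    have hcoe := coe_asTest (exists_cutoff_mul hχ hrap hε0')
    rw [coe_schwartzDeriv, hcoe] at hsum
    have hdiff := hsum.sub (hG φ)
    have hloc : ∀ x : ℝ, 1 < x → deriv (fun x => (χ (x / ε) : ℂ) * h x) x = deriv h x :=
      fun x hx => by
        refine Filter.EventuallyEq.deriv_eq ?_
        filter_upwards [Ioi_mem_nhds hx] with y hy
        have hy' : 1 < y := hy
        rw [h1 _ ((le_div_iff₀ hε0').mpr ?_), Complex.ofReal_one, one_mul]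
        nlinarith [le_abs_self R]
    have hterm : ∀ ℓ : ℕ, ℓ ≠ 0 → c ℓ * -weyl (1 - w) (deriv fun x => (χ (x / ε) : ℂ) * h x) ℓ
        - c ℓ * (φ : 𝓢(ℝ, ℂ)) ℓ = 0 := fun ℓ hℓ => by
      have hℓ' : (1 : ℝ) ≤ ℓ := by exact_mod_cast Nat.one_le_iff_ne_zero.mpr hℓ
      have h2 : weyl (1 - w) (deriv fun x => (χ (x / ε) : ℂ) * h x) ℓ
          = weyl (1 - w) (deriv h) ℓ := by
        refine setIntegral_congr_fun measurableSet_Ioi fun y hy => ?_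
        have hy' : 0 < y := hy
        rw [hloc _ (by linarith)]
      rw [h2, weyl_deriv_neg_weyl hw0 hw1, neg_neg, sub_self]
    have h3 := hdiff.unique (hasSum_single 0 hterm)
    rw [Nat.cast_zero, hφ0, mul_zero, sub_zero] at h3
    linear_combination -h3
  refine HasFinitePart.congr_eventually ?_ hsplit
  have h0 : HasFinitePart
      (fun ε => weyl (1 - w) (deriv fun x => (χ (x / ε) : ℂ) * h x) 0) 0 := by
    by_cases hw00 : w = 0
    · refine HasFinitePart.zero.congr fun ε hε => ?_
      have hcoe := coe_asTest (exists_cutoff_mul hχ hrap hε)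
      rw [← hcoe, ← coe_schwartzDeriv, hw00, sub_zero, weyl_one_deriv]
      have := (asTest fun x => (χ (x / ε) : ℂ) * h x).2.1 0
      rw [iteratedDeriv_zero] at this
      rw [this, neg_zero]
    · have h4 := hasFinitePart_weyl_deriv_cutoff_mul hv (by simpa using hw00) hχ hrap
      rwa [weyl_deriv_neg_weyl hw0 hw1, hφ0, neg_zero] at h4
  simpa using (HasFinitePart.const (G φ)).add (h0.smul (-c 0))

/-! ### Binomial coefficients -/

theorem cbinom_zero {z : ℂ} (hz : 0 < z.re) : cbinom z 0 = 1 := by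
  have h := Complex.Gamma_ne_zero_of_re_pos (s := z + 1) (by simp; linarith)
  simp [cbinom, h]

theorem cbinom_succ (z : ℂ) (ℓ : ℕ) :
    cbinom z (ℓ + 1) = cbinom z ℓ * ((z - ℓ) / (ℓ + 1)) := by
  have h1 : (Complex.Gamma (z - ℓ))⁻¹ = (z - ℓ) * (Complex.Gamma (z - ℓ + 1))⁻¹ :=
    Complex.one_div_Gamma_eq_self_mul_one_div_Gamma_add_one _
  have h2 : Complex.Gamma ((ℓ : ℂ) + 1 + 1) = (ℓ + 1) * Complex.Gamma (ℓ + 1) :=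
    Complex.Gamma_add_one _ (Nat.cast_add_one_ne_zero ℓ)
  simp only [cbinom, Nat.cast_succ, div_eq_mul_inv, mul_inv, h2]
  rw [show z - ((ℓ : ℂ) + 1) + 1 = z - ℓ by ring, h1]
  ring

theorem cbinom_eq_choose {z : ℂ} (hz : 0 < z.re) (ℓ : ℕ) : cbinom z ℓ = Ring.choose z ℓ := by
  have key : ∀ n : ℕ, (n.factorial : ℂ) * Ring.choose z n = (descPochhammer ℤ n).smeval z :=
    fun n => by rw [Ring.descPochhammer_eq_factorial_smul_choose, nsmul_eq_mul]
  induction ℓ with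
  | zero => rw [cbinom_zero hz, Ring.choose_zero_right]
  | succ ℓ ih =>
    have h1 := key (ℓ + 1)
    rw [descPochhammer_succ_right, Polynomial.smeval_mul, ← key ℓ, Polynomial.smeval_sub,
      Polynomial.smeval_natCast, Polynomial.smeval_X, Nat.factorial_succ] at h1
    have hf : (ℓ.factorial : ℂ) ≠ 0 := by exact_mod_cast ℓ.factorial_ne_zero
    have hl : ((ℓ : ℂ) + 1) ≠ 0 := Nat.cast_add_one_ne_zero ℓ
    rw [cbinom_succ, ih]
    rw [mul_div_assoc', div_eq_iff hl]
    apply mul_left_cancel₀ hf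
    simp only [pow_one, pow_zero, nsmul_eq_mul, mul_one] at h1
    push_cast at h1
    linear_combination -h1

theorem exists_norm_cbinom_le {z : ℂ} (hz : 0 < z.re) : ∃ M : ℝ, ∀ ℓ, ‖cbinom z ℓ‖ ≤ M := by
  obtain ⟨N, hN⟩ := exists_nat_ge (‖z‖ ^ 2)
  -- beyond `‖z‖ ^ 2` the quotient of consecutive coefficients is at most one in absolute value
  have hstep : ∀ ℓ, N ≤ ℓ → ‖cbinom z (ℓ + 1)‖ ≤ ‖cbinom z ℓ‖ := fun ℓ hℓ => by
    rw [cbinom_succ, norm_mul]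
    refine mul_le_of_le_one_right (norm_nonneg _) ?_
    have hℓ' : ‖z‖ ^ 2 ≤ (ℓ : ℝ) := hN.trans (by exact_mod_cast hℓ)
    have hn : ‖(ℓ : ℂ) + 1‖ = (ℓ : ℝ) + 1 := by
      have := Complex.norm_natCast (ℓ + 1)
      push_cast at this
      exact this
    rw [norm_div, hn, div_le_one (by positivity)]
    refine le_of_sq_le_sq ?_ (by positivity)
    rw [Complex.sq_norm, Complex.normSq_apply] at *
    simp only [Complex.sub_re, Complex.sub_im, Complex.natCast_re, Complex.natCast_im, sub_zero]
    nlinarith [mul_nonneg (Nat.cast_nonneg (α := ℝ) ℓ) hz.le]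
  refine ⟨∑ ℓ ∈ Finset.range (N + 1), ‖cbinom z ℓ‖, fun ℓ => ?_⟩
  have hsmall : ∀ ℓ, ℓ ≤ N → ‖cbinom z ℓ‖ ≤ ∑ ℓ ∈ Finset.range (N + 1), ‖cbinom z ℓ‖ :=
    fun ℓ hℓ => Finset.single_le_sum (f := fun ℓ => ‖cbinom z ℓ‖) (fun _ _ => norm_nonneg _)
      (Finset.mem_range.mpr (Nat.lt_succ_of_le hℓ))
  rcases le_total ℓ N with h | h
  · exact hsmall ℓ h
  · induction ℓ, h using Nat.le_induction with
    | base => exact hsmall N le_rfl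
    | succ ℓ hℓ ih => exact (hstep ℓ hℓ).trans ih

/-- The binomial series, at `-q`. -/
theorem hasSum_cbinom_mul_pow {z : ℂ} (hz : 0 < z.re) {q : ℂ} (hq : ‖q‖ < 1) :
    HasSum (fun ℓ => cbinom z ℓ * (-1) ^ ℓ * q ^ ℓ) ((1 - q) ^ z) := by
  have h := (Complex.one_add_cpow_hasFPowerSeriesOnBall_zero (a := z)).hasSum (y := -q)
    (by simpa [← ENNReal.ofReal_one, Metric.eball_ofReal] using hq)
  rw [zero_add] at h
  convert! h using 1
  ext ℓ
  rw [binomialSeries_apply, cbinom_eq_choose hz]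
  simp [neg_pow q ℓ, mul_assoc]

/-! ### Series of translated truncated powers -/

/-- The series `∑ ℓ, c ℓ K_z(· - ℓ)`, which is locally a finite sum. -/
noncomputable def splineSeries (c : ℕ → ℂ) (z : ℂ) (x : ℝ) : ℂ := ∑' ℓ : ℕ, c ℓ * K z (x - ℓ)

theorem splineSeries_eq_sum (c : ℕ → ℂ) (z : ℂ) {x : ℝ} {N : ℕ} (hx : x ≤ N) :
    splineSeries c z x = ∑ ℓ ∈ Finset.range N, c ℓ * K z (x - ℓ) := by
  refine tsum_eq_sum fun ℓ hℓ => ?_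
  have h1 : (N : ℝ) ≤ ℓ := by
    rw [Finset.mem_range, not_lt] at hℓ
    exact_mod_cast hℓ
  rw [K_of_nonpos (by linarith), mul_zero]

theorem continuous_K {z : ℂ} (hz : 1 < z.re) : Continuous (K z) := by
  have hz1 : 0 < (z - 1).re := by simp; linarith
  have h : K z = fun x : ℝ => ((max x 0 : ℝ) : ℂ) ^ (z - 1) / Complex.Gamma z := by
    ext x
    rcases le_or_gt x 0 with hx | hx
    · have : z - 1 ≠ 0 := fun h0 => by rw [h0] at hz1; simp at hz1
      rw [K_of_nonpos hx, max_eq_right hx, Complex.ofReal_zero, Complex.zero_cpow this, zero_div]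
    · rw [K, if_pos hx, max_eq_left hx.le]
  rw [h]
  exact ((Complex.continuous_ofReal_cpow_const hz1).comp
    (continuous_id.max continuous_const)).div_const _

theorem continuous_splineSeries (c : ℕ → ℂ) {z : ℂ} (hz : 1 < z.re) :
    Continuous (splineSeries c z) := by
  rw [continuous_iff_continuousAt]
  intro x
  obtain ⟨N, hN⟩ := exists_nat_gt x
  have hc : Continuous fun x : ℝ => ∑ ℓ ∈ Finset.range N, c ℓ * K z (x - ℓ) :=
    continuous_finsetSum _ fun ℓ _ => continuous_const.mul
      ((continuous_K hz).comp (continuous_id.sub continuous_const))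
  refine hc.continuousAt.congr ?_
  filter_upwards [Iio_mem_nhds hN] with y hy
  exact (splineSeries_eq_sum c z (le_of_lt hy)).symm

theorem norm_splineSeries_le {c : ℕ → ℂ} {M : ℝ} (hM : ∀ ℓ, ‖c ℓ‖ ≤ M) {z : ℂ} (hz : 1 < z.re)
    {x : ℝ} (hx : 0 < x) :
    ‖splineSeries c z x‖ ≤ M * ‖Complex.Gamma z‖⁻¹ * (1 + x) ^ (⌈z.re⌉₊ + 1) := by
  have hM0 : 0 ≤ M := (norm_nonneg _).trans (hM 0)
  have hx1 : x ^ (z.re - 1) ≤ (1 + x) ^ ⌈z.re⌉₊ := by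
    calc x ^ (z.re - 1) ≤ (1 + x) ^ (z.re - 1) := by
          gcongr
          linarith
      _ ≤ (1 + x) ^ (⌈z.re⌉₊ : ℝ) := by
          gcongr
          · linarith
          · linarith [Nat.le_ceil z.re]
      _ = _ := Real.rpow_natCast _ _
  have hterm : ∀ ℓ : ℕ, ‖c ℓ * K z (x - ℓ)‖ ≤ M * ‖Complex.Gamma z‖⁻¹ * (1 + x) ^ ⌈z.re⌉₊ := by
    intro ℓ
    rcases le_or_gt (x - ℓ) 0 with h | h
    · rw [K_of_nonpos h, mul_zero, norm_zero]; positivity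
    · rw [norm_mul, norm_K h, div_eq_mul_inv, mul_assoc M]
      refine mul_le_mul (hM ℓ) ?_ (by positivity) hM0
      rw [mul_comm]
      gcongr
      refine le_trans ?_ hx1
      gcongr
      linarith [Nat.cast_nonneg (α := ℝ) ℓ]
  rw [splineSeries_eq_sum c z (Nat.le_ceil x)]
  refine (norm_sum_le_of_le _ fun ℓ _ => hterm ℓ).trans ?_
  rw [Finset.sum_const, Finset.card_range, nsmul_eq_mul, pow_succ]
  calc (⌈x⌉₊ : ℝ) * (M * ‖Complex.Gamma z‖⁻¹ * (1 + x) ^ ⌈z.re⌉₊)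
      ≤ (1 + x) * (M * ‖Complex.Gamma z‖⁻¹ * (1 + x) ^ ⌈z.re⌉₊) :=
        mul_le_mul_of_nonneg_right (by linarith [Nat.ceil_lt_add_one hx.le]) (by positivity)
    _ = _ := by ring

/-- Integration against a translated truncated power is a Weyl integral. -/
theorem setIntegral_K_sub_mul (z : ℂ) (g : ℝ → ℂ) {t : ℝ} (ht : 0 ≤ t) :
    ∫ x in Ioi (0 : ℝ), K z (x - t) * g x = ∫ y in Ioi (0 : ℝ), K z y * g (t + y) := by
  have h1 : ∫ x in Ioi (0 : ℝ), K z (x - t) * g x = ∫ x, K z (x - t) * g x :=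
    setIntegral_eq_integral_of_forall_compl_eq_zero fun x hx => by
      have hx' : x ≤ 0 := not_lt.mp hx
      rw [K_of_nonpos (by linarith), zero_mul]
  have h2 := weyl_eq_integral z g t
  rw [weyl] at h2
  rw [h1, h2, ← integral_add_right_eq_self _ t]
  congr 1; ext y
  rw [add_sub_cancel_right, add_comm]

theorem hasSum_weyl_of_isRegular {c : ℕ → ℂ} {M : ℝ} (hM : ∀ ℓ, ‖c ℓ‖ ≤ M) {z : ℂ}
    (hz : 0 < z.re) {u : LizorkinDual} (hu : IsRegular u (splineSeries c z))
    (θ : lizorkinPlus) : HasSum (fun ℓ : ℕ => c ℓ * weyl z (θ : 𝓢(ℝ, ℂ)) ℓ) (u θ) := by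
  have hint : ∀ ℓ : ℕ, IntegrableOn (fun x => c ℓ * (K z (x - ℓ) * (θ : 𝓢(ℝ, ℂ)) x)) (Ioi 0) :=
    fun ℓ => by
      have h1 : Integrable (fun y => K z y * (θ : 𝓢(ℝ, ℂ)) (ℓ + y)) :=
        (integrableOn_iff_integrable_of_support_subset fun y hy =>
          support_K_subset z fun h => hy (by simp [h])).mp (integrableOn_weyl hz _ _)
      have h2 := h1.comp_sub_right (ℓ : ℝ)
      simp only [add_sub_cancel] at h2
      exact (h2.const_mul (c ℓ)).integrableOn
  have hnorm : ∀ ℓ : ℕ, ∫ x in Ioi (0 : ℝ), ‖c ℓ * (K z (x - ℓ) * (θ : 𝓢(ℝ, ℂ)) x)‖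
      = ‖c ℓ‖ * ∫ y in Ioi (0 : ℝ), ‖K z y * (θ : 𝓢(ℝ, ℂ)) (ℓ + y)‖ := fun ℓ => by
    have h1 : ∫ x in Ioi (0 : ℝ), ‖K z (x - ℓ) * (θ : 𝓢(ℝ, ℂ)) x‖
        = ∫ x, ‖K z (x - ℓ) * (θ : 𝓢(ℝ, ℂ)) x‖ :=
      setIntegral_eq_integral_of_forall_compl_eq_zero fun x hx => by
        have hx' : x ≤ 0 := not_lt.mp hx
        rw [K_of_nonpos (by linarith [Nat.cast_nonneg (α := ℝ) ℓ]), zero_mul, norm_zero]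
    have h2 : ∫ y in Ioi (0 : ℝ), ‖K z y * (θ : 𝓢(ℝ, ℂ)) (ℓ + y)‖
        = ∫ y, ‖K z y * (θ : 𝓢(ℝ, ℂ)) (ℓ + y)‖ :=
      setIntegral_eq_integral_of_forall_compl_eq_zero fun x hx => by
        rw [K_of_nonpos (not_lt.mp hx), zero_mul, norm_zero]
    simp only [norm_mul (c ℓ), integral_const_mul]
    rw [h1, h2, ← integral_add_right_eq_self _ (ℓ : ℝ)]
    congr 2; ext y
    rw [add_sub_cancel_right, add_comm]
  obtain ⟨C, hC0, hC⟩ := weyl_norm_decay hz (θ : 𝓢(ℝ, ℂ)) 2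
  have hsum : Summable fun ℓ : ℕ =>
      ∫ x in Ioi (0 : ℝ), ‖c ℓ * (K z (x - ℓ) * (θ : 𝓢(ℝ, ℂ)) x)‖ := by
    refine Summable.of_nonneg_of_le (fun ℓ => integral_nonneg fun x => norm_nonneg _)
      (fun ℓ => ?_) (summable_inv_one_add_sq.mul_left (M * C))
    rw [hnorm, mul_assoc]
    exact mul_le_mul (hM ℓ) (hC ℓ (Nat.cast_nonneg ℓ))
      (integral_nonneg fun x => norm_nonneg _) ((norm_nonneg _).trans (hM 0))
  have h := hasSum_integral_of_summable_integral_norm hint hsum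
  rw [(hu θ).2]
  convert! h using 1
  · ext ℓ
    rw [integral_const_mul, setIntegral_K_sub_mul z _ (Nat.cast_nonneg ℓ), weyl]
  · congr 1; ext x
    rw [splineSeries, ← tsum_mul_right]
    congr 1; ext ℓ
    ring

theorem exists_isRegular_splineSeries {c : ℕ → ℂ} {M : ℝ} (hM : ∀ ℓ, ‖c ℓ‖ ≤ M) {z : ℂ}
    (hz : 1 < z.re) : ∃ u : LizorkinDual, IsRegular u (splineSeries c z) :=
  exists_isRegular (continuous_splineSeries c hz).measurable
    fun _ hx => norm_splineSeries_le hM hz hx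

theorem splineSeries_single {z : ℂ} (hz : 0 < z.re) {x : ℝ} (hx : 0 < x) :
    splineSeries (Pi.single 0 (Complex.Gamma z)) z x = (x : ℂ) ^ (z - 1) := by
  rw [splineSeries, tsum_eq_single 0 fun ℓ hℓ => by simp [hℓ]]
  have := Complex.Gamma_ne_zero_of_re_pos hz
  simp only [Pi.single_eq_same, Nat.cast_zero, sub_zero, K, if_pos hx]
  field_simp

/-! ### The Laplace transform of the truncated power -/

theorem integrableOn_norm_K_mul_exp {v : ℂ} (hv : 0 < v.re) {b : ℝ} (hb : 0 < b) :
    IntegrableOn (fun y => ‖K v y‖ * Real.exp (-b * y)) (Ioi 0) := by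
  have h := (integrableOn_rpow_mul_exp_neg_mul_rpow (p := 1) (s := v.re - 1) (by linarith)
    one_pos hb).const_mul ‖Complex.Gamma v‖⁻¹
  refine IntegrableOn.congr_fun h (fun y hy => ?_) measurableSet_Ioi
  have hy' : 0 < y := hy
  simp only [Real.rpow_one, norm_K hy']
  ring

theorem norm_cexp_neg_mul (s : ℂ) (y : ℝ) : ‖Complex.exp (-(s * y))‖ = Real.exp (-s.re * y) := by
  rw [Complex.norm_exp]; simp

theorem integrableOn_K_mul_cexp {v : ℂ} (hv : 0 < v.re) {s : ℂ} (hs : 0 < s.re) :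
    IntegrableOn (fun y => K v y * Complex.exp (-(s * y))) (Ioi 0) := by
  refine (integrableOn_norm_K_mul_exp hv hs).mono'
    ((measurable_K v).mul (by fun_prop)).aestronglyMeasurable (Eventually.of_forall fun y => ?_)
  rw [norm_mul, norm_cexp_neg_mul]

theorem ofReal_mul_K {v : ℂ} (hv : v ≠ 0) (y : ℝ) : y * K v y = v * K (v + 1) y := by
  rcases le_or_gt y 0 with h | h
  · simp [K_of_nonpos h]
  · have hy : (y : ℂ) ≠ 0 := by exact_mod_cast h.ne'
    rw [K, K, if_pos h, if_pos h, add_sub_cancel_right, Complex.Gamma_add_one v hv,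
      mul_div_assoc', mul_div_assoc', mul_div_mul_left _ _ hv, Complex.cpow_sub _ _ hy,
      Complex.cpow_one, mul_div_cancel₀ _ hy]

theorem hasDerivAt_laplace_K {v : ℂ} (hv : 0 < v.re) {s : ℂ} (hs : 0 < s.re) :
    HasDerivAt (fun s : ℂ => ∫ y in Ioi (0 : ℝ), K v y * Complex.exp (-(s * y)))
      (∫ y in Ioi (0 : ℝ), K v y * (Complex.exp (-(s * y)) * -y)) s := by
  have hv0 : v ≠ 0 := fun h => by simp [h] at hv
  have hv1 : 0 < (v + 1).re := by simp; linarith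
  have hmeas : ∀ s : ℂ, AEStronglyMeasurable (fun y : ℝ => K v y * Complex.exp (-(s * y)))
      (volume.restrict (Ioi 0)) := fun s =>
    ((measurable_K v).mul (by fun_prop)).aestronglyMeasurable
  refine (hasDerivAt_integral_of_dominated_loc_of_deriv_le
    (s := {t : ℂ | s.re / 2 < t.re})
    ((isOpen_lt continuous_const Complex.continuous_re).mem_nhds (show s.re / 2 < s.re by linarith))
    (Eventually.of_forall hmeas) (integrableOn_K_mul_cexp hv hs)
    (F' := fun s y => K v y * (Complex.exp (-(s * y)) * -y))
    (bound := fun y => ‖v‖ * (‖K (v + 1) y‖ * Real.exp (-(s.re / 2) * y)))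
    (hF'_meas := ((measurable_K v).mul (by fun_prop)).aestronglyMeasurable)
    (h_bound := ?_) (bound_integrable :=
      (integrableOn_norm_K_mul_exp hv1 (show 0 < s.re / 2 by linarith)).const_mul _)
    (h_diff := ?_)).2
  · filter_upwards [ae_restrict_mem measurableSet_Ioi] with y hy t ht
    have hy' : 0 < y := hy
    have ht' : s.re / 2 < t.re := ht
    have h1 : K v y * (Complex.exp (-(t * y)) * -y)
        = -(v * K (v + 1) y) * Complex.exp (-(t * y)) := by
      rw [← ofReal_mul_K hv0]; ring
    rw [h1, norm_mul, norm_neg, norm_mul, norm_cexp_neg_mul, mul_assoc]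
    gcongr
  · refine Eventually.of_forall fun y t _ => ?_
    have h1 : HasDerivAt (fun t : ℂ => -(t * y)) (-y : ℂ) t := by
      simpa using ((hasDerivAt_id t).mul_const (y : ℂ)).fun_neg
    exact h1.cexp.const_mul _

/-- The Laplace transform of `K v` is `s ^ (-v)`. For real `s` this is Euler's integral, and both
sides are analytic on the right half-plane. -/
theorem laplace_K {v : ℂ} (hv : 0 < v.re) {s : ℂ} (hs : 0 < s.re) :
    ∫ y in Ioi (0 : ℝ), K v y * Complex.exp (-(s * y)) = s ^ (-v) := by
  set U : Set ℂ := {t : ℂ | 0 < t.re} with hU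
  have hUo : IsOpen U := isOpen_lt continuous_const Complex.continuous_re
  have hf : AnalyticOnNhd ℂ
      (fun s : ℂ => ∫ y in Ioi (0 : ℝ), K v y * Complex.exp (-(s * y))) U :=
    DifferentiableOn.analyticOnNhd
      (fun t ht => (hasDerivAt_laplace_K hv ht).differentiableAt.differentiableWithinAt) hUo
  have hg : AnalyticOnNhd ℂ (fun s : ℂ => s ^ (-v)) U :=
    DifferentiableOn.analyticOnNhd (fun t ht =>
      (differentiableAt_id.cpow_const (Or.inl ht)).differentiableWithinAt) hUo
  have hreal : ∀ r : ℝ, 0 < r →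
      ∫ y in Ioi (0 : ℝ), K v y * Complex.exp (-((r : ℂ) * y)) = (r : ℂ) ^ (-v) := fun r hr => by
    have h1 := Complex.integral_cpow_mul_exp_neg_mul_Ioi hv hr
    have hG := Complex.Gamma_ne_zero_of_re_pos hv
    have h2 : ∫ y in Ioi (0 : ℝ), K v y * Complex.exp (-((r : ℂ) * y))
        = (Complex.Gamma v)⁻¹ * ∫ y in Ioi (0 : ℝ), (y : ℂ) ^ (v - 1) *
          Complex.exp (-((r : ℂ) * y)) := by
      rw [← integral_const_mul]
      refine setIntegral_congr_fun measurableSet_Ioi fun y hy => ?_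
      have hy' : 0 < y := hy
      simp only [K, if_pos hy']
      ring
    rw [h2, h1, one_div, Complex.inv_cpow _ _ (by
      rw [Complex.arg_ofReal_of_nonneg hr.le]; exact Real.pi_pos.ne), Complex.cpow_neg]
    field_simp
  have hfreq : ∃ᶠ t in 𝓝[≠] (1 : ℂ),
      ∫ y in Ioi (0 : ℝ), K v y * Complex.exp (-(t * y)) = t ^ (-v) := by
    have ht : Tendsto (fun n : ℕ => ((1 + 1 / ((n : ℝ) + 1) : ℝ) : ℂ)) atTop (𝓝[≠] 1) := by
      refine tendsto_nhdsWithin_iff.mpr ⟨?_, Eventually.of_forall fun n => ?_⟩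
      · have h1 := (tendsto_one_div_add_atTop_nhds_zero_nat (𝕜 := ℝ)).const_add 1
        rw [add_zero] at h1
        exact (Complex.continuous_ofReal.tendsto 1).comp h1
      · have h2 : (1 : ℝ) / ((n : ℝ) + 1) ≠ 0 := by positivity
        simp only [mem_compl_iff, mem_singleton_iff, ← Complex.ofReal_one, Complex.ofReal_inj]
        intro h3
        exact h2 (by linarith)
    exact ht.frequently (Eventually.of_forall fun n => hreal _ (by positivity)).frequently
  exact hf.eqOn_of_preconnected_of_frequently_eq hg
    (convex_halfSpace_re_gt 0).isPreconnected (show (1 : ℂ) ∈ U by simp [hU]) hfreq hs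

/-! ### The symbol of the exponential B-spline -/

theorem Ω_eq {a : ℝ≥0} {ξ : ℝ} (h : ((a : ℝ) : ℂ) + Complex.I * ξ ≠ 0) :
    Ω a ξ = (1 - Complex.exp (-(((a : ℝ) : ℂ) + Complex.I * ξ)))
      / (((a : ℝ) : ℂ) + Complex.I * ξ) := if_neg h

theorem norm_Ω_le (a : ℝ≥0) (ξ : ℝ) : ‖Ω a ξ‖ ≤ 4 * (1 + |ξ|)⁻¹ := by
  set s : ℂ := ((a : ℝ) : ℂ) + Complex.I * ξ with hs
  have hre : s.re = a := by simp [hs]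
  have him : s.im = ξ := by simp [hs]
  have hξ : |ξ| ≤ ‖s‖ := him ▸ Complex.abs_im_le_norm s
  rw [← div_eq_mul_inv, le_div_iff₀ (by positivity)]
  by_cases h0 : s = 0
  · have : |ξ| ≤ 0 := by simpa [h0] using hξ
    rw [Ω, if_pos h0, norm_one]
    linarith
  · have hpos : 0 < ‖s‖ := norm_pos_iff.mpr h0
    rw [Ω_eq h0, norm_div, div_mul_eq_mul_div, div_le_iff₀ hpos]
    have h2 : ‖1 - Complex.exp (-s)‖ ≤ 2 := by
      refine (norm_sub_le _ _).trans ?_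
      rw [norm_one, Complex.norm_exp, Complex.neg_re, hre]
      have : Real.exp (-(a : ℝ)) ≤ 1 := Real.exp_le_one_iff.mpr (by simp)
      linarith
    rcases le_or_gt ‖s‖ 1 with h1 | h1
    · have h3 := Complex.norm_exp_sub_one_le (x := -s) (by rwa [norm_neg])
      rw [norm_sub_rev, norm_neg] at h3
      nlinarith [norm_nonneg (1 - Complex.exp (-s))]
    · nlinarith [norm_nonneg (1 - Complex.exp (-s))]

theorem norm_Ω_cpow_le (a : ℝ≥0) {z : ℂ} (hz : 0 < z.re) (ξ : ℝ) :
    ‖Ω a ξ ^ z‖ ≤ 4 ^ z.re * Real.exp (Real.pi * |z.im|) * (1 + ‖ξ‖) ^ (-z.re) := by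
  refine (Complex.norm_cpow_le _ _).trans ?_
  rw [div_eq_mul_inv, ← Real.exp_neg, mul_right_comm]
  have h1 : ‖Ω a ξ‖ ^ z.re ≤ 4 ^ z.re * (1 + ‖ξ‖) ^ (-z.re) := by
    rw [Real.rpow_neg (by positivity), ← Real.inv_rpow (by positivity),
      ← Real.mul_rpow (by norm_num) (by positivity), Real.norm_eq_abs]
    gcongr
    exact norm_Ω_le a ξ
  gcongr
  rw [← neg_mul]
  refine (le_abs_self _).trans ?_
  rw [abs_mul, abs_neg]
  gcongr
  exact Complex.abs_arg_le_pi _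

theorem measurable_Ω_cpow (a : ℝ≥0) (z : ℂ) : Measurable fun ξ : ℝ => Ω a ξ ^ z := by
  have h : Measurable (Ω a) := by
    unfold Ω
    refine Measurable.ite ?_ measurable_const (by fun_prop)
    exact measurableSet_eq_fun (by fun_prop) measurable_const
  exact h.pow_const z

theorem integrable_Ω_bound {z : ℂ} (hz : 1 < z.re) :
    Integrable fun ξ : ℝ =>
      4 ^ z.re * Real.exp (Real.pi * |z.im|) * (1 + ‖ξ‖) ^ (-z.re) :=
  (integrable_one_add_norm (by simpa using hz)).const_mul _

theorem integrable_Ω_cpow (a : ℝ≥0) {z : ℂ} (hz : 1 < z.re) :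
    Integrable fun ξ : ℝ => Ω a ξ ^ z :=
  (integrable_Ω_bound hz).mono' (measurable_Ω_cpow a z).aestronglyMeasurable
    (Eventually.of_forall fun ξ => norm_Ω_cpow_le a (by linarith) ξ)

/-- For `a > 0` numerator and denominator of the symbol lie in the right half-plane, so the
principal power is multiplicative on them. -/
theorem Ω_cpow_eq {a : ℝ≥0} (ha : 0 < a) (z : ℂ) (ξ : ℝ) :
    Ω a ξ ^ z = (1 - Complex.exp (-(((a : ℝ) : ℂ) + Complex.I * ξ))) ^ z *
      (((a : ℝ) : ℂ) + Complex.I * ξ) ^ (-z) := by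
  set s : ℂ := ((a : ℝ) : ℂ) + Complex.I * ξ with hs
  have hre : 0 < s.re := by simpa [hs] using ha
  have hs0 : s ≠ 0 := fun h => by simp [h] at hre
  set N : ℂ := 1 - Complex.exp (-s) with hN
  have hNre : 0 < N.re := by
    have h1 : (Complex.exp (-s)).re < 1 := by
      refine (Complex.re_le_norm _).trans_lt ?_
      rw [Complex.norm_exp, Complex.neg_re, Real.exp_lt_one_iff]
      linarith
    simp only [hN, Complex.sub_re, Complex.one_re]
    linarith
  have hN0 : N ≠ 0 := fun h => by simp [h] at hNre
  have hargs := abs_lt.mp (Complex.abs_arg_lt_pi_div_two_iff.mpr (Or.inl hre))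
  have hargN := abs_lt.mp (Complex.abs_arg_lt_pi_div_two_iff.mpr (Or.inl hNre))
  have hspi : s.arg ≠ Real.pi := by have := Real.pi_pos; intro h; linarith
  have hlog : Complex.log (N * s⁻¹) = Complex.log N - Complex.log s := by
    rw [(Complex.log_mul_eq_add_log_iff hN0 (inv_ne_zero hs0)).mpr, Complex.log_inv _ hspi,
      sub_eq_add_neg]
    rw [Complex.arg_inv, if_neg hspi]
    constructor <;> linarith
  rw [Ω_eq hs0, div_eq_mul_inv, Complex.cpow_def_of_ne_zero (mul_ne_zero hN0 (inv_ne_zero hs0)),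
    hlog, Complex.cpow_def_of_ne_zero hN0, Complex.cpow_def_of_ne_zero hs0, ← Complex.exp_add]
  congr 1
  ring

/-- For `a = 0` the symbol meets the negative real axis only in its zeros. -/
theorem Ω_zero_mem_slitPlane {ξ : ℝ} (hξ : ξ ≠ 0) (h : Ω 0 ξ ≠ 0) : Ω 0 ξ ∈ Complex.slitPlane := by
  have hξc : (ξ : ℂ) ≠ 0 := by exact_mod_cast hξ
  have hne : (((0 : ℝ≥0) : ℝ) : ℂ) + Complex.I * ξ ≠ 0 := by simp [hξ]
  have hval : Ω 0 ξ = ((Real.sin ξ / ξ : ℝ) : ℂ)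
      + ((-(1 - Real.cos ξ) / ξ : ℝ) : ℂ) * Complex.I := by
    rw [Ω_eq hne]
    have he : Complex.exp (-((((0 : ℝ≥0) : ℝ) : ℂ) + Complex.I * ξ))
        = Real.cos ξ - Real.sin ξ * Complex.I := by
      rw [show -((((0 : ℝ≥0) : ℝ) : ℂ) + Complex.I * ξ) = ((-ξ : ℝ) : ℂ) * Complex.I by
        push_cast; simp; ring, Complex.exp_mul_I, ← Complex.ofReal_cos, ← Complex.ofReal_sin,
        Real.cos_neg, Real.sin_neg]
      push_cast; ring
    rw [he]
    push_cast
    rw [zero_add]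
    field_simp
    linear_combination (1 - Complex.cos (ξ : ℂ)) * Complex.I_sq
  have hre : (Ω 0 ξ).re = Real.sin ξ / ξ := by rw [hval]; simp [-Complex.ofReal_div]
  have him : (Ω 0 ξ).im = -(1 - Real.cos ξ) / ξ := by rw [hval]; simp [-Complex.ofReal_div]
  refine Or.inr fun h0 => h (Complex.ext ?_ h0)
  rw [him, div_eq_zero_iff, or_iff_left hξ] at h0
  have hsin : Real.sin ξ = 0 := by nlinarith [Real.sin_sq_add_cos_sq ξ]
  rw [hre, hsin, zero_div, Complex.zero_re]

theorem tendsto_Ω_cpow {α : ℕ → ℝ≥0} (hα : Tendsto α atTop (𝓝 0)) {z : ℂ} (hz : 0 < z.re) {ξ : ℝ}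
    (hξ : ξ ≠ 0) : Tendsto (fun n => Ω (α n) ξ ^ z) atTop (𝓝 (Ω 0 ξ ^ z)) := by
  have hne : ∀ a : ℝ≥0, ((a : ℝ) : ℂ) + Complex.I * ξ ≠ 0 := fun a h => by
    have := congrArg Complex.im h
    simp [hξ] at this
  have h1 : Tendsto (fun n => Ω (α n) ξ) atTop (𝓝 (Ω 0 ξ)) := by
    have hc : Continuous fun a : ℝ≥0 => Ω a ξ := by
      have : (fun a : ℝ≥0 => Ω a ξ) = fun a : ℝ≥0 =>
          (1 - Complex.exp (-(((a : ℝ) : ℂ) + Complex.I * ξ)))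
            / (((a : ℝ) : ℂ) + Complex.I * ξ) := funext fun a => Ω_eq (hne a)
      rw [this]
      refine Continuous.div ?_ ?_ hne <;> fun_prop
    exact (hc.tendsto 0).comp hα
  by_cases h0 : Ω 0 ξ = 0
  · rw [h0] at h1 ⊢
    have h2 := (Complex.continuousAt_cpow_zero_of_re_pos hz).tendsto.comp
      (h1.prodMk_nhds (tendsto_const_nhds (x := z)))
    exact h2
  · exact h1.cpow tendsto_const_nhds (Ω_zero_mem_slitPlane hξ h0)

/-! ### The exponential B-spline as a series of truncated powers -/

/-- The coefficients of the fractional difference operator of order `z`. -/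
noncomputable def diffCoeff (z : ℂ) (ℓ : ℕ) : ℂ := cbinom z ℓ * (-1) ^ ℓ

theorem exists_norm_diffCoeff_le {z : ℂ} (hz : 0 < z.re) :
    ∃ M : ℝ, ∀ ℓ, ‖diffCoeff z ℓ‖ ≤ M := by
  obtain ⟨M, hM⟩ := exists_norm_cbinom_le hz
  exact ⟨M, fun ℓ => by simpa [diffCoeff] using hM ℓ⟩

theorem splineSeries_of_nonpos (c : ℕ → ℂ) (z : ℂ) {x : ℝ} (hx : x ≤ 0) :
    splineSeries c z x = 0 := by
  simpa using splineSeries_eq_sum c z (N := 0) (by simpa using hx)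

theorem integrable_splineSeries_mul_exp {c : ℕ → ℂ} {M : ℝ} (hM : ∀ ℓ, ‖c ℓ‖ ≤ M) {z : ℂ}
    (hz : 1 < z.re) {a : ℝ} (ha : 0 < a) :
    Integrable fun x : ℝ => splineSeries c z x * (Real.exp (-a * x) : ℂ) := by
  set N := ⌈z.re⌉₊ + 1 with hN
  set C := M * ‖Complex.Gamma z‖⁻¹ with hC
  have hC0 : 0 ≤ C := mul_nonneg ((norm_nonneg _).trans (hM 0)) (by positivity)
  have hcont : Continuous fun x : ℝ => splineSeries c z x * (Real.exp (-a * x) : ℂ) :=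
    (continuous_splineSeries c hz).mul (by fun_prop)
  rw [← integrableOn_iff_integrable_of_support_subset (s := Ioi 0) fun x hx => by
    by_contra h
    exact hx (by simp [splineSeries_of_nonpos c z (not_lt.mp h)])]
  set D : ℝ := C * (N.factorial / (a / 2) ^ N * Real.exp (a / 2)) with hD
  refine ((exp_neg_integrableOn_Ioi 0 (half_pos ha)).const_mul D).mono'
    hcont.aestronglyMeasurable ?_
  filter_upwards [ae_restrict_mem measurableSet_Ioi] with x hx
  have hx' : 0 < x := hx
  rw [norm_mul, Complex.norm_real, Real.norm_of_nonneg (Real.exp_pos _).le]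
  have h1 := norm_splineSeries_le hM hz hx'
  have h2 : (1 + x) ^ N ≤ N.factorial / (a / 2) ^ N * Real.exp (a / 2 * (1 + x)) := by
    have h3 := Real.pow_div_factorial_le_exp (a / 2 * (1 + x)) (by positivity) N
    rw [mul_pow, div_le_iff₀ (by positivity)] at h3
    rw [div_mul_eq_mul_div, le_div_iff₀ (by positivity)]
    linarith
  calc ‖splineSeries c z x‖ * Real.exp (-a * x)
      ≤ C * (N.factorial / (a / 2) ^ N * Real.exp (a / 2 * (1 + x))) * Real.exp (-a * x) := by
        gcongr
        exact h1.trans (by gcongr)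
    _ = C * (N.factorial / (a / 2) ^ N * (Real.exp (a / 2 * (1 + x)) * Real.exp (-a * x))) := by
        ring
    _ = D * Real.exp (-(a / 2) * x) := by
        rw [← Real.exp_add, hD, mul_assoc C, mul_assoc _ (Real.exp (a / 2)), ← Real.exp_add]
        ring_nf

/-- The Fourier transform of the exponentially damped spline series is a power of the symbol, by
the binomial series. -/
theorem integral_splineSeries_mul_cexp {a : ℝ≥0} (ha : 0 < a) {z : ℂ} (hz : 1 < z.re) (ξ : ℝ) :
    ∫ x : ℝ, splineSeries (diffCoeff z) z x * Complex.exp (-((((a : ℝ) : ℂ) + Complex.I * ξ) * x))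
      = Ω a ξ ^ z := by
  have hz0 : 0 < z.re := by linarith
  set s : ℂ := ((a : ℝ) : ℂ) + Complex.I * ξ with hs
  have hre : 0 < s.re := by simpa [hs] using ha
  obtain ⟨M, hM⟩ := exists_norm_diffCoeff_le hz0
  set q : ℂ := Complex.exp (-s) with hq
  have hq1 : ‖q‖ < 1 := by
    rw [hq, Complex.norm_exp, Complex.neg_re, Real.exp_lt_one_iff]; linarith
  have hK : Integrable fun y : ℝ => K z y * Complex.exp (-(s * y)) :=
    (integrableOn_iff_integrable_of_support_subset fun y hy =>
      support_K_subset z fun h => hy (by simp [h])).mp (integrableOn_K_mul_cexp hz0 hre)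
  have hKint : ∫ y : ℝ, K z y * Complex.exp (-(s * y)) = s ^ (-z) := by
    rw [← laplace_K hz0 hre]
    symm
    exact setIntegral_eq_integral_of_forall_compl_eq_zero fun y hy => by
      rw [K_of_nonpos (not_lt.mp hy), zero_mul]
  have hshift : ∀ (ℓ : ℕ) (x : ℝ), diffCoeff z ℓ * K z (x - ℓ) * Complex.exp (-(s * x))
      = diffCoeff z ℓ * q ^ ℓ *
        (K z (x - ℓ) * Complex.exp (-(s * ((x - ℓ : ℝ) : ℂ)))) := fun ℓ x => by
    have : Complex.exp (-(s * x)) = q ^ ℓ * Complex.exp (-(s * ((x - ℓ : ℝ) : ℂ))) := by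
      rw [hq, ← Complex.exp_nat_mul, ← Complex.exp_add]
      congr 1
      push_cast
      ring
    rw [this]; ring
  have hint : ∀ ℓ : ℕ,
      Integrable fun x : ℝ => diffCoeff z ℓ * K z (x - ℓ) * Complex.exp (-(s * x)) := fun ℓ => by
    simp only [hshift]
    exact (hK.comp_sub_right (ℓ : ℝ)).const_mul _
  have hval : ∀ ℓ : ℕ, ∫ x : ℝ, diffCoeff z ℓ * K z (x - ℓ) * Complex.exp (-(s * x))
      = diffCoeff z ℓ * q ^ ℓ * s ^ (-z) := fun ℓ => by
    simp only [hshift]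
    rw [integral_const_mul,
      integral_sub_right_eq_self (fun y : ℝ => K z y * Complex.exp (-(s * y))) (ℓ : ℝ), hKint]
  have hnorm : ∀ ℓ : ℕ, ∫ x : ℝ, ‖diffCoeff z ℓ * K z (x - ℓ) * Complex.exp (-(s * x))‖
      = ‖diffCoeff z ℓ‖ * ‖q‖ ^ ℓ * ∫ y : ℝ, ‖K z y * Complex.exp (-(s * y))‖ := fun ℓ => by
    simp only [hshift, norm_mul (diffCoeff z ℓ * q ^ ℓ)]
    rw [integral_const_mul, integral_sub_right_eq_self
      (fun y : ℝ => ‖K z y * Complex.exp (-(s * y))‖) (ℓ : ℝ), norm_mul, norm_pow]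
  have hsum : Summable fun ℓ : ℕ =>
      ∫ x : ℝ, ‖diffCoeff z ℓ * K z (x - ℓ) * Complex.exp (-(s * x))‖ := by
    simp only [hnorm]
    refine Summable.mul_right _ (Summable.of_nonneg_of_le (fun ℓ => by positivity) (fun ℓ => ?_)
      ((summable_geometric_of_lt_one (norm_nonneg q) hq1).mul_left M))
    gcongr
    exact hM ℓ
  have h := hasSum_integral_of_summable_integral_norm hint hsum
  simp only [hval] at h
  have h' := (hasSum_cbinom_mul_pow hz0 hq1).mul_right (s ^ (-z))
  rw [Ω_cpow_eq ha, ← hs, ← hq, ← h.unique h']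
  congr 1; ext x
  rw [splineSeries, ← tsum_mul_right]

theorem expBSpline_eq_of_pos {a : ℝ≥0} (ha : 0 < a) {z : ℂ} (hz : 1 < z.re) (x : ℝ) :
    expBSpline a z x = splineSeries (diffCoeff z) z x * (Real.exp (-(a : ℝ) * x) : ℂ) := by
  obtain ⟨M, hM⟩ := exists_norm_diffCoeff_le (z := z) (by linarith)
  set f : ℝ → ℂ := fun x => splineSeries (diffCoeff z) z x * (Real.exp (-(a : ℝ) * x) : ℂ) with hf
  have hfc : Continuous f := (continuous_splineSeries _ hz).mul (by fun_prop)
  have hfi : Integrable f := integrable_splineSeries_mul_exp hM hz (by exact_mod_cast ha)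
  have hFT : FourierTransform.fourier f = fun v : ℝ => Ω a (2 * Real.pi * v) ^ z := by
    ext v
    rw [Real.fourier_real_eq_integral_exp_smul, ← integral_splineSeries_mul_cexp ha hz]
    congr 1; ext t
    rw [smul_eq_mul, hf]
    simp only
    rw [Complex.ofReal_exp, mul_left_comm, ← Complex.exp_add]
    congr 2
    push_cast
    ring
  have hFi : Integrable (FourierTransform.fourier f) := by
    rw [hFT]
    exact (integrable_Ω_cpow a hz).comp_mul_left' (by positivity)
  have hinv := congrFun (hfc.fourierInv_fourier_eq hfi hFi) x
  change _ = f x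
  rw [← hinv, Real.fourierInv_eq', hFT, expBSpline]
  have hscale := Measure.integral_comp_mul_left
    (fun ξ : ℝ => Ω a ξ ^ z * Complex.exp (Complex.I * ξ * x)) (2 * Real.pi)
  rw [abs_of_pos (by positivity), Complex.real_smul] at hscale
  rw [show (1 / (2 * Real.pi) : ℂ) = (((2 * Real.pi)⁻¹ : ℝ) : ℂ) by push_cast; ring, ← hscale]
  congr 1; ext v
  rw [smul_eq_mul, mul_comm]
  congr 2
  simp
  ring

/-- The exponential B-spline is the exponentially damped series of truncated powers; the case
`a = 0` is the limit `a ↓ 0`. -/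
theorem expBSpline_eq (a : ℝ≥0) {z : ℂ} (hz : 1 < z.re) (x : ℝ) :
    expBSpline a z x = splineSeries (diffCoeff z) z x * (Real.exp (-(a : ℝ) * x) : ℂ) := by
  rcases eq_or_lt_of_le (zero_le : 0 ≤ a) with rfl | ha
  · set α : ℕ → ℝ≥0 := fun n => 1 / ((n : ℝ≥0) + 1) with hα
    have hα0 : Tendsto α atTop (𝓝 0) := tendsto_one_div_add_atTop_nhds_zero_nat
    have h1 : Tendsto (fun n => expBSpline (α n) z x) atTop (𝓝 (expBSpline 0 z x)) := by
      refine Tendsto.const_mul _ (tendsto_integral_filter_of_dominated_convergence _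
        (Eventually.of_forall fun n => ?_) (Eventually.of_forall fun n =>
          Eventually.of_forall fun ξ => ?_) (integrable_Ω_bound hz) ?_)
      · exact ((measurable_Ω_cpow _ z).mul (by fun_prop)).aestronglyMeasurable
      · have h2 : ‖Complex.exp (Complex.I * ξ * x)‖ = 1 := by
          rw [Complex.norm_exp]; simp
        rw [norm_mul, h2, mul_one]
        exact norm_Ω_cpow_le _ (by linarith) ξ
      · filter_upwards [compl_mem_ae_iff.mpr (measure_singleton (0 : ℝ))] with ξ hξ
        exact (tendsto_Ω_cpow hα0 (by linarith) hξ).mul_const _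
    have h2 : Tendsto (fun n => splineSeries (diffCoeff z) z x *
        (Real.exp (-(α n : ℝ) * x) : ℂ)) atTop
        (𝓝 (splineSeries (diffCoeff z) z x * (Real.exp (-((0 : ℝ≥0) : ℝ) * x) : ℂ))) := by
      have hc : Continuous fun b : ℝ≥0 => splineSeries (diffCoeff z) z x *
        (Real.exp (-(b : ℝ) * x) : ℂ) := by fun_prop
      exact (hc.tendsto 0).comp hα0
    refine tendsto_nhds_unique h1 (h2.congr fun n => ?_)
    exact (expBSpline_eq_of_pos (by positivity) hz x).symm
  · exact expBSpline_eq_of_pos ha hz x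

/-! ### Elements of the kernel and the differential equation -/

/-- A constant has vanishing derivatives, so it lies in the kernel of every `D ^ z`. -/
theorem mem_fracDeriv_graph_const {z : ℂ} (hz : 0 < z.re) {u : LizorkinDual}
    (hu : IsRegular u fun _ => 1) : (u, 0) ∈ (fracDeriv z).graph := by
  have hD : weakDeriv u = 0 := by
    ext θ
    change -(u (derivTest θ)) = 0
    have h1 : u (derivTest θ) = weyl 1 (schwartzDeriv (θ : 𝓢(ℝ, ℂ))) 0 := by
      rw [(hu _).2, weyl]
      refine setIntegral_congr_fun measurableSet_Ioi fun x hx => ?_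
      have hx' : 0 < x := hx
      simp only [K, if_pos hx', sub_self, Complex.cpow_zero, Complex.Gamma_one, div_one, zero_add]
      rfl
    have h2 : (θ : 𝓢(ℝ, ℂ)) 0 = 0 := by simpa using θ.2.1 0
    rw [h1, weyl_one_deriv, h2, neg_zero, neg_zero]
  have hn : 0 < ⌈z.re⌉₊ := Nat.ceil_pos.mpr hz
  obtain ⟨k, hk⟩ := Nat.exists_eq_succ_of_ne_zero hn.ne'
  rw [mem_fracDeriv_graph_iff, hk, pow_succ, Module.End.mul_apply, hD, map_zero]
  intro φ χ _
  exact HasFinitePart.zero.congr fun ε _ => by simp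

theorem mem_fracDeriv_graph_of_isRegular {z : ℂ} (hz : 1 < z.re) {c : ℕ → ℂ} {M : ℝ}
    (hM : ∀ ℓ, ‖c ℓ‖ ≤ M) {u G : LizorkinDual} (hu : IsRegular u (splineSeries c z))
    (hG : IsDeltaSeries G c) : (u, G) ∈ (fracDeriv z).graph :=
  mem_fracDeriv_graph_of_hasSum hz (hasSum_weyl_of_isRegular hM (by linarith) hu) hG

theorem mem_fracDeriv_graph_cpow {z : ℂ} (hz : 1 < z.re) {u : LizorkinDual}
    (hu : IsRegular u fun x => (x : ℂ) ^ (z - 1)) : (u, 0) ∈ (fracDeriv z).graph := by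
  have hM : ∀ ℓ : ℕ, ‖(Pi.single 0 (Complex.Gamma z) : ℕ → ℂ) ℓ‖ ≤ ‖Complex.Gamma z‖ := fun ℓ => by
    rcases eq_or_ne ℓ 0 with rfl | h
    · simp
    · simp [h]
  refine mem_fracDeriv_graph_of_isRegular hz hM
    (hu.congr fun x hx => (splineSeries_single (by linarith) hx).symm) fun φ => ?_
  -- the Dirac distribution at the origin vanishes on test functions
  have h0 : (φ : 𝓢(ℝ, ℂ)) 0 = 0 := by simpa using φ.2.1 0
  have hzero : ∀ ℓ : ℕ, (Pi.single 0 (Complex.Gamma z) : ℕ → ℂ) ℓ * (φ : 𝓢(ℝ, ℂ)) (ℓ : ℝ) = 0 :=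
    fun ℓ => by
      rcases eq_or_ne ℓ 0 with rfl | h
      · simp [h0]
      · simp [h]
  simp only [hzero]
  exact hasSum_zero

theorem exists_isRegular_cpow {z : ℂ} (hz : 1 < z.re) :
    ∃ u : LizorkinDual, IsRegular u fun x => (x : ℂ) ^ (z - 1) := by
  refine exists_isRegular (Complex.measurable_ofReal.pow_const _) (C := 1) (N := ⌈z.re⌉₊)
    fun x hx => ?_
  rw [Complex.norm_cpow_eq_rpow_re_of_pos hx, one_mul, ← Real.rpow_natCast]
  have hx' : 0 < x := hx
  calc x ^ (z - 1).re ≤ (1 + x) ^ (z - 1).re := by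
        gcongr
        · simp; linarith
        · linarith
    _ ≤ (1 + x) ^ (⌈z.re⌉₊ : ℝ) := by
        gcongr
        · linarith
        · have := Nat.le_ceil z.re
          simp; linarith

theorem mem_expFracKer {a : ℝ≥0} {z : ℂ} {u : LizorkinDual} (h : (u, 0) ∈ (fracDeriv z).graph) :
    expMul a u ∈ expFracKer a z :=
  (mem_expFracDeriv_graph_iff a z _ _).mpr ⟨u, 0, h, rfl, (map_zero _).symm⟩

end ComplexSpline

theorem mainTheorem4 (a : ℝ≥0) (z : ℂ) (hz : 1 < z.re) :
    -- the operator is well defined by its defining relation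
    (∀ F G : ComplexSpline.LizorkinDual,
      (F, G) ∈ (ComplexSpline.expFracDeriv a z).graph ↔
        ∃ f g : ComplexSpline.LizorkinDual, (f, g) ∈ (ComplexSpline.fracDeriv z).graph ∧
          F = ComplexSpline.expMul a f ∧ G = ComplexSpline.expMul a g) ∧
    -- the constant one is in the dual, and the exponential is in the kernel
    (∃ u : ComplexSpline.LizorkinDual, ComplexSpline.IsRegular u (fun _ => 1)) ∧
    (∃ F ∈ ComplexSpline.expFracKer a z,
      ComplexSpline.IsRegular F (fun x => (Real.exp (-(a : ℝ) * x) : ℂ))) ∧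
    -- the complex monomial is in the dual, and its product with the exponential is in the kernel
    (∃ u : ComplexSpline.LizorkinDual,
      ComplexSpline.IsRegular u (fun x => (x : ℂ) ^ (z - 1))) ∧
    (∃ F ∈ ComplexSpline.expFracKer a z,
      ComplexSpline.IsRegular F
        (fun x => (x : ℂ) ^ (z - 1) * (Real.exp (-(a : ℝ) * x) : ℂ))) ∧
    -- the exponential B-spline solves the fractional differential equation
    (∃ F G : ComplexSpline.LizorkinDual,
      ComplexSpline.IsRegular F (ComplexSpline.expBSpline a z) ∧
      ComplexSpline.IsDeltaSeries G (fun ℓ =>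
        ComplexSpline.cbinom z ℓ * (-1) ^ ℓ * (Real.exp (-(ℓ : ℝ) * (a : ℝ)) : ℂ)) ∧
      (F, G) ∈ (ComplexSpline.expFracDeriv a z).graph ∧
      ComplexSpline.IsExponentialSpline a z F) := by
  have hz0 : 0 < z.re := by linarith
  obtain ⟨u, hu⟩ := ComplexSpline.exists_isRegular (f := fun _ => 1) measurable_const
    (C := 1) (N := 0) (by simp)
  obtain ⟨v, hv⟩ := ComplexSpline.exists_isRegular_cpow hz
  obtain ⟨M, hM⟩ := ComplexSpline.exists_norm_diffCoeff_le hz0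
  obtain ⟨f, hf⟩ := ComplexSpline.exists_isRegular_splineSeries hM hz
  obtain ⟨g, hg⟩ := ComplexSpline.exists_isDeltaSeries hM
  have hgraph : (ComplexSpline.expMul a f, ComplexSpline.expMul a g) ∈
      (ComplexSpline.expFracDeriv a z).graph :=
    (ComplexSpline.mem_expFracDeriv_graph_iff a z _ _).mpr
      ⟨f, g, ComplexSpline.mem_fracDeriv_graph_of_isRegular hz hM hf hg, rfl, rfl⟩
  refine ⟨ComplexSpline.mem_expFracDeriv_graph_iff a z, ⟨u, hu⟩,
    ⟨_, ComplexSpline.mem_expFracKer (ComplexSpline.mem_fracDeriv_graph_const hz0 hu),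
      by simpa using hu.expMul a⟩, ⟨v, hv⟩,
    ⟨_, ComplexSpline.mem_expFracKer (ComplexSpline.mem_fracDeriv_graph_cpow hz hv), hv.expMul a⟩,
    _, _, (hf.expMul a).congr fun x _ => (ComplexSpline.expBSpline_eq a hz x).symm,
    hg.expMul a, hgraph, _, ⟨M, fun ℓ => ?_⟩, _, hg.expMul a, hgraph⟩
  rw [norm_mul, Complex.norm_real, Real.norm_of_nonneg (Real.exp_pos _).le]
  refine (mul_le_of_le_one_right (norm_nonneg _) (Real.exp_le_one_iff.mpr ?_)).trans (hM ℓ)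
  have : (0 : ℝ) ≤ ℓ * a := by positivity
  linarith
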